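/- **Fermions.** Let $K$ be a field of characteristic $0$ (for instance $\mathbb{C}$, or $\mathbb{C}(x_1,\dots,x_n,t_1,\dots,t_n)$). Let $\psi^*_i,\psi_i$ ($i\in\mathbb{Z}-\frac12$) be the creation and annihilation operators on the fermionic Fock space $\mathcal F$, so $[\psi_i,\psi_j]_+=[\psi_i^*,\psi_j^*]_+=0$ and $[\psi_i,\psi_j^*]_+=\delta_{i,j}$, with vacuum $|\emptyset\rangle$ in which exactly the negative positions are occupied. For $m\in\mathbb{Z}$ let $J_m=\sum_{i}{:}\psi^*_{i-m}\psi_i{:}$, and $$\phi_\pm(x;t)=\sum_{q\ge1}\tfrac1q\bigl(1-(-t)^q\bigr)x^{\pm q}J_{\pm q}.$$ For a strictly decreasing sequence of positive integers $\mu=(\mu_1>\dots>\mu_m)$ put $|\mu\rangle=\psi^*_{\mu_1-1/2}\cdots\psi^*_{\mu_m-1/2}|\emptyset\rangle$ and $\langle\mu|=\langle\emptyset|\psi_{\mu_m-1/2}\cdots\psi_{\mu_1-1/2}$, where $\langle\emptyset|$ takes the coefficient of $|\emptyset\rangle$. (Since $J_{\pm q}$ changes the energy by exactly $\mp q$, every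 bra-ket below is a finite sum.) **Ice.** Let $n\ge1$, let $\lambda=(\lambda_1>\dots>\lambda_n>0)$ be integers, and let $x_i\in K^\times$, $t_i\in K$ for $1\le i\le n$. A state $A\in\mathfrak A^\lambda$ is an orientation of the edges of the rectangular grid with rows $n,\dots,1$ (from top to bottom) and columns $\lambda_1,\dots,1$ (from left to right) such that every vertex has two incoming and two outgoing edges, the left and right boundary edges point inward, the bottom boundary edges point down, and the top boundary edge of column $j$ points up if and only if $j$ is a part of $\lambda$. The local weights of a vertex in row $j$ are, with (left, right, top, bottom) the directions of its four edges: $$\begin{array}{c|cccccc} & (\to,\to,\downarrow,\downarrow)&(\leftarrow,\leftarrow,\uparrow,\uparrow)&(\to,\to,\uparrow,\uparrow)&(\leftarrow,\leftarrow,\downarrow,\downarrow)&(\leftarrow,\to,\downarrow,\uparrow)&(\to,\leftarrow,\uparrow,\downarrow)\\ \hline \Delta&1&t_jx_j&1&x_j&x_j(t_j+1)&1\\ \Gamma&1&x_{n-j+1}&t_{n-j+1}&x_{n-j+1}&x_{n-j+1}(t_{n-j+1}+1)&1\end{array}$$ Let $\mathrm{wt}_\Delta(A;i)$ and $\mathrm{wt}_\Gamma(A;i)$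 be the products of the local weights over row $i$, let $\mathrm{wt}_\Delta(A)$ and $\mathrm{wt}_\Gamma(A)$ be the products over all vertices, and let $\mathcal Z_\Delta(\mathfrak A^\lambda)$ and $\mathcal Z_\Gamma(\mathfrak A^\lambda)$ be the sums of these over $A\in\mathfrak A^\lambda$. **Statement.** Sending $A$ to the sequence $(\lambda^{(n)},\dots,\lambda^{(1)})$, where $\lambda^{(i)}$ consists of the columns whose edge north of row $i$ points up, is a bijection from $\mathfrak A^\lambda$ onto the strict Gelfand–Tsetlin patterns with top row $\lambda$. With $\lambda^{(0)}=\emptyset$, for every $A\in\mathfrak A^\lambda$ and $1\le i\le n$, $$(-1)^i(t_i+1)x_i\,\mathrm{wt}_\Delta(A;i)=\langle\lambda^{(i-1)}|e^{\phi_+(x_i;t_i)}\psi_{-\frac12}|\lambda^{(i)}\rangle,$$ $$(t_{n-i+1}+1)x_{n-i+1}^{-\lambda_1}\,\mathrm{wt}_\Gamma(A;i)=\langle\lambda^{(i-1)}|\psi_{\lambda_1+\frac12}e^{\phi_-(x_{n-i+1};t_{n-i+1})}|\lambda^{(i)}\rangle.$$ Consequently $$\Bigl(\prod_{i=1}^n(-1)^i(t_i+1)x_i\Bigr)\mathrm{wt}_\Delta(A)=\prod_{i=1}^n\langle\lambda^{(i-1)}|e^{\phi_+(x_i;t_i)}\psi_{-\frac12}|\lambda^{(i)}\rangle,$$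 $$\Bigl(\prod_{i=1}^n(t_{n-i+1}+1)x_{n-i+1}^{-\lambda_1}\Bigr)\mathrm{wt}_\Gamma(A)=\prod_{i=1}^n\langle\lambda^{(i-1)}|\psi_{\lambda_1+\frac12}e^{\phi_-(x_{n-i+1};t_{n-i+1})}|\lambda^{(i)}\rangle,$$ and, with operator products written so that the factor $i=1$ is leftmost, $$\Bigl(\prod_{i=1}^n(-1)^i(t_i+1)x_i\Bigr)\mathcal Z_\Delta(\mathfrak A^\lambda)=\Bigl\langle\emptyset\Bigm|\prod_{i=1}^n\bigl[e^{\phi_+(x_i;t_i)}\psi_{-\frac12}\bigr]\Bigm|\lambda\Bigr\rangle,$$ $$\Bigl(\prod_{i=1}^n(t_{n-i+1}+1)x_{n-i+1}^{-\lambda_1}\Bigr)\mathcal Z_\Gamma(\mathfrak A^\lambda)=\Bigl\langle\emptyset\Bigm|\prod_{i=1}^n\bigl[\psi_{\lambda_1+\frac12}e^{\phi_-(x_{n-i+1};t_{n-i+1})}\bigr]\Bigm|\lambda\Bigr\rangle.$$ -/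

import Mathlib

namespace IceFock

/-! ## Fermionic Fock space

Fermions sit at the half-integers `k - 1/2`, `k : ℤ`.  Throughout, the half-integer `k - 1/2` is
encoded by the integer `k`; so `ψ_{-1/2}` is `psi 0` and `ψ*_{a - 1/2}` is `psiStar a`, and a
half-integer is positive iff its code is. -/

/-- A configuration of fermions: all but finitely many positive positions are empty, and all but
finitely many negative positions are occupied. -/
@[ext] structure Maya where
  carrier : Set ℤ
  finite_particles : {k | k ∈ carrier ∧ 0 < k}.Finite
  finite_holes : {k | k ∉ carrier ∧ k ≤ 0}.Finite

namespace Maya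

/-- The vacuum: exactly the negative half-integers are occupied. -/
def vac : Maya where
  carrier := {k | k ≤ 0}
  finite_particles := by
    convert Set.finite_empty (α := ℤ) using 1
    ext k; simp
  finite_holes := by
    convert Set.finite_empty (α := ℤ) using 1
    ext k; simp

/-- Add a particle at position `k`. -/
def add (k : ℤ) (S : Maya) : Maya where
  carrier := insert k S.carrier
  finite_particles := by
    refine (S.finite_particles.insert k).subset ?_
    rintro j ⟨h | h, hj⟩
    · exact Or.inl h
    · exact Or.inr ⟨h, hj⟩
  finite_holes := by
    refine S.finite_holes.subset ?_
    rintro j ⟨h, hj⟩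
    exact ⟨fun h' => h (Or.inr h'), hj⟩

/-- Remove the particle at position `k`. -/
def remove (k : ℤ) (S : Maya) : Maya where
  carrier := S.carrier \ {k}
  finite_particles := by
    refine S.finite_particles.subset ?_
    rintro j ⟨h, hj⟩
    exact ⟨h.1, hj⟩
  finite_holes := by
    refine (S.finite_holes.insert k).subset ?_
    rintro j ⟨h, hj⟩
    by_cases hjk : j = k
    · exact Or.inl hjk
    · exact Or.inr ⟨fun h' => h ⟨h', hjk⟩, hj⟩

/-- The number of particles strictly to the right of position `k`. -/
noncomputable def numRight (k : ℤ) (S : Maya) : ℕ :=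
  {j | j ∈ S.carrier ∧ k < j}.ncard

theorem finite_right (k : ℤ) (S : Maya) : {j | j ∈ S.carrier ∧ k < j}.Finite := by
  refine (S.finite_particles.union (Set.finite_Ioc k 0)).subset ?_
  rintro j ⟨h, hj⟩
  by_cases h0 : 0 < j
  · exact Or.inl ⟨h, h0⟩
  · exact Or.inr ⟨hj, not_lt.mp h0⟩

end Maya

variable (K : Type*) [Field K]

/-- The fermionic Fock space over `K`, with basis the configurations of fermions. -/
abbrev Fock : Type _ := Maya →₀ K

/-- The vacuum vector `|0⟩ = |∅⟩`. -/
noncomputable def vacuum : Fock K := Finsupp.single Maya.vac 1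

open Classical in
/-- The creation operator `ψ*_{k - 1/2}`. -/
noncomputable def psiStar (k : ℤ) : Module.End K (Fock K) :=
  Finsupp.linearCombination K fun S : Maya =>
    if k ∈ S.carrier then 0 else Finsupp.single (S.add k) ((-1 : K) ^ S.numRight k)

open Classical in
/-- The annihilation operator `ψ_{k - 1/2}`. -/
noncomputable def psi (k : ℤ) : Module.End K (Fock K) :=
  Finsupp.linearCombination K fun S : Maya =>
    if k ∈ S.carrier then Finsupp.single (S.remove k) ((-1 : K) ^ S.numRight k) else 0

/-- The normally ordered product `:ψ*_{i - 1/2} ψ_{j - 1/2}:`. -/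
noncomputable def normalOrdered (i j : ℤ) : Module.End K (Fock K) :=
  if 0 < i then psiStar K i * psi K j else -(psi K j * psiStar K i)

/-- The current operators `J_m = ∑_k :ψ*_{k - m} ψ_k:`, `m : ℤ`.  On each basis vector the sum is
finite, see `finite_support_J`. -/
noncomputable def J (m : ℤ) : Module.End K (Fock K) :=
  Finsupp.linearCombination K fun S : Maya =>
    ∑ᶠ k : ℤ, normalOrdered K (k - m) k (Finsupp.single S 1)

/-! ### Formal series of operators

The operators `J_q`, `J_{-q}` change the energy by exactly `q`.  Infinite sums of operators are
kept as formal sums `∑_d A_d` of operators on Fock space graded by the amount of energy moved, that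
is, as power series with coefficients in the endomorphism ring. -/

/-- Formal sums `∑_d A_d` of operators. -/
abbrev OpSeries : Type _ := PowerSeries (Module.End K (Fock K))

variable {K}

/-- An operator, as a formal sum concentrated in degree `0`. -/
noncomputable def op (A : Module.End K (Fock K)) : OpSeries K := PowerSeries.C A

/-- `φ₊(x;t) = ∑_{q ≥ 1} (1/q) (1 - (-t)^q) x^q J_q`. -/
noncomputable def phiPlus (x t : K) : OpSeries K :=
  PowerSeries.mk fun q : ℕ =>
    if q = 0 then 0 else ((1 / (q : K)) * (1 - (-t) ^ q) * x ^ q) • J K (q : ℤ)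

/-- `φ₋(x;t) = ∑_{q ≥ 1} (1/q) (1 - (-t)^q) x^{-q} J_{-q}`. -/
noncomputable def phiMinus (x t : K) : OpSeries K :=
  PowerSeries.mk fun q : ℕ =>
    if q = 0 then 0 else ((1 / (q : K)) * (1 - (-t) ^ q) * (x⁻¹) ^ q) • J K (-(q : ℤ))

/-- The exponential `∑_m φ^m / m!` of a formal sum without term in degree `0`; since `φ^m` then
has no term in degree less than `m`, only `m ≤ d` contributes in degree `d`. -/
noncomputable def expOp (φ : OpSeries K) : OpSeries K :=
  PowerSeries.mk fun d : ℕ =>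
    ∑ m ∈ Finset.range (d + 1), ((m.factorial : K)⁻¹) • PowerSeries.coeff d (φ ^ m)

/-- The state `|λ⟩ = ψ*_{λ₁ - 1/2} ⋯ ψ*_{λₙ - 1/2} |0⟩`. -/
noncomputable def ket {n : ℕ} (lam : Fin n → ℕ) : Fock K :=
  (List.ofFn fun i => psiStar K (lam i : ℤ)).prod (vacuum K)

/-- The functional `⟨μ| = ⟨0| ψ_{μₘ - 1/2} ⋯ ψ_{μ₁ - 1/2}`, where `⟨0|` is the coefficient of the
vacuum vector. -/
noncomputable def bra {m : ℕ} (mu : Fin m → ℕ) (v : Fock K) : K :=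
  ((List.ofFn fun i => psi K (mu i : ℤ)).reverse.prod v) Maya.vac

/-- The bra-ket `⟨μ| ∑_d A_d |λ⟩ = ∑_d ⟨μ| A_d |λ⟩`. In the uses below at most one
`d` contributes, for reasons of energy. -/
noncomputable def braket {m n : ℕ} (mu : Fin m → ℕ) (A : OpSeries K) (lam : Fin n → ℕ) : K :=
  ∑ᶠ d : ℕ, bra mu (PowerSeries.coeff d A (ket lam))

/-! ### Consistency of the Fock representation -/

section Consistency

variable (K)

set_option linter.unusedSimpArgs false

open Classical in
theorem psiStar_single (k : ℤ) (S : Maya) (c : K) :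
    psiStar K k (Finsupp.single S c) =
      if k ∈ S.carrier then 0 else Finsupp.single (S.add k) ((-1 : K) ^ S.numRight k * c) := by
  unfold psiStar
  rw [Finsupp.linearCombination_single]
  split_ifs <;> simp [mul_comm]

open Classical in
theorem psi_single (k : ℤ) (S : Maya) (c : K) :
    psi K k (Finsupp.single S c) =
      if k ∈ S.carrier then Finsupp.single (S.remove k) ((-1 : K) ^ S.numRight k * c) else 0 := by
  unfold psi
  rw [Finsupp.linearCombination_single]
  split_ifs <;> simp [mul_comm]

theorem Maya.numRight_add_of_lt {i j : ℤ} {S : Maya} (hj : j ∉ S.carrier) (h : i < j) :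
    (S.add j).numRight i = S.numRight i + 1 := by
  unfold Maya.numRight Maya.add
  have : {l | l ∈ insert j S.carrier ∧ i < l} = insert j {l | l ∈ S.carrier ∧ i < l} := by
    ext l
    simp only [Set.mem_insert_iff, Set.mem_ofPred_eq]
    grind
  rw [this, Set.ncard_insert_of_notMem (fun h' => hj h'.1) (S.finite_right i)]

theorem Maya.numRight_add_of_le {i j : ℤ} {S : Maya} (h : j ≤ i) :
    (S.add j).numRight i = S.numRight i := by
  unfold Maya.numRight Maya.add
  congr 1
  ext l
  simp only [Set.mem_insert_iff, Set.mem_ofPred_eq]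
  grind

theorem Maya.add_remove {j : ℤ} {S : Maya} (hj : j ∈ S.carrier) : (S.remove j).add j = S := by
  ext l
  simp only [Maya.add, Maya.remove, Set.mem_insert_iff, Set.mem_sdiff, Set.mem_singleton_iff]
  grind

theorem Maya.remove_add {j : ℤ} {S : Maya} (hj : j ∉ S.carrier) : (S.add j).remove j = S := by
  ext l
  simp only [Maya.add, Maya.remove, Set.mem_insert_iff, Set.mem_sdiff, Set.mem_singleton_iff]
  grind

theorem Maya.numRight_remove_of_lt {i j : ℤ} {S : Maya} (hj : j ∈ S.carrier) (h : i < j) :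
    (S.remove j).numRight i + 1 = S.numRight i := by
  have hn : j ∉ (S.remove j).carrier := fun h' => h'.2 rfl
  rw [← Maya.numRight_add_of_lt hn h, Maya.add_remove hj]

theorem Maya.numRight_remove_of_le {i j : ℤ} {S : Maya} (hj : j ∈ S.carrier) (h : j ≤ i) :
    (S.remove j).numRight i = S.numRight i := by
  rw [← Maya.numRight_add_of_le (S := S.remove j) h, Maya.add_remove hj]

theorem Maya.add_comm (i j : ℤ) (S : Maya) : (S.add i).add j = (S.add j).add i := by
  ext l
  simp only [Maya.add, Set.mem_insert_iff]
  grind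

theorem Maya.remove_comm (i j : ℤ) (S : Maya) : (S.remove i).remove j = (S.remove j).remove i := by
  ext l
  simp only [Maya.remove, Set.mem_sdiff, Set.mem_singleton_iff]
  grind

theorem Maya.add_remove_comm {i j : ℤ} (hij : i ≠ j) (S : Maya) :
    (S.add i).remove j = (S.remove j).add i := by
  ext l
  simp only [Maya.remove, Maya.add, Set.mem_sdiff, Set.mem_insert_iff, Set.mem_singleton_iff]
  grind

theorem Maya.mem_add {i j : ℤ} {S : Maya} : i ∈ (S.add j).carrier ↔ i = j ∨ i ∈ S.carrier :=
  Iff.rfl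

theorem Maya.mem_remove {i j : ℤ} {S : Maya} :
    i ∈ (S.remove j).carrier ↔ i ∈ S.carrier ∧ i ≠ j :=
  Iff.rfl

/-- `[ψ*_i, ψ*_j]₊ = 0`. -/
theorem psiStar_anticomm (i j : ℤ) :
    psiStar K i * psiStar K j + psiStar K j * psiStar K i = 0 := by
  wlog h : i ≤ j generalizing i j
  · rw [_root_.add_comm]; exact this j i (le_of_not_ge h)
  refine Finsupp.lhom_ext fun S c => ?_
  simp only [LinearMap.add_apply, Module.End.mul_apply, LinearMap.zero_apply, psiStar_single]
  rcases h.eq_or_lt with rfl | h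
  · by_cases hi : i ∈ S.carrier <;> simp [-Finsupp.single_mul, hi, psiStar_single, Maya.mem_add]
  · by_cases hi : i ∈ S.carrier <;> by_cases hj : j ∈ S.carrier <;>
      simp [-Finsupp.single_mul, hi, hj, psiStar_single, Maya.mem_add, h.ne, h.ne']
    rw [Maya.numRight_add_of_lt hj h, Maya.numRight_add_of_le h.le, Maya.add_comm,
      ← Finsupp.single_add]
    refine Eq.trans (congrArg _ ?_) (Finsupp.single_zero _)
    ring

/-- `[ψ_i, ψ_j]₊ = 0`. -/
theorem psi_anticomm (i j : ℤ) : psi K i * psi K j + psi K j * psi K i = 0 := by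
  wlog h : i ≤ j generalizing i j
  · rw [_root_.add_comm]; exact this j i (le_of_not_ge h)
  refine Finsupp.lhom_ext fun S c => ?_
  simp only [LinearMap.add_apply, Module.End.mul_apply, LinearMap.zero_apply, psi_single]
  rcases h.eq_or_lt with rfl | h
  · by_cases hi : i ∈ S.carrier <;> simp [-Finsupp.single_mul, hi, psi_single, Maya.mem_remove]
  · by_cases hi : i ∈ S.carrier <;> by_cases hj : j ∈ S.carrier <;>
      simp [-Finsupp.single_mul, hi, hj, psi_single, Maya.mem_remove, h.ne, h.ne']
    rw [← Maya.numRight_remove_of_lt hj h, Maya.numRight_remove_of_le hi h.le, Maya.remove_comm,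
      ← Finsupp.single_add]
    refine Eq.trans (congrArg _ ?_) (Finsupp.single_zero _)
    ring

/-- `[ψ_i, ψ*_j]₊ = δ_{i,j}`. -/
theorem psi_psiStar_anticomm (i j : ℤ) :
    psi K i * psiStar K j + psiStar K j * psi K i = if i = j then 1 else 0 := by
  refine Finsupp.lhom_ext fun S c => ?_
  simp only [LinearMap.add_apply, Module.End.mul_apply, psi_single, psiStar_single]
  have hsq : ∀ a : ℕ, (-1 : K) ^ a * ((-1) ^ a * c) = c := fun a => by
    rw [← mul_assoc, ← mul_pow]; simp
  rcases lt_trichotomy i j with h | rfl | h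
  · by_cases hi : i ∈ S.carrier <;> by_cases hj : j ∈ S.carrier <;>
      simp [-Finsupp.single_mul, hi, hj, psi_single, psiStar_single, Maya.mem_remove, Maya.mem_add, h.ne, h.ne']
    rw [Maya.numRight_add_of_lt hj h, Maya.numRight_remove_of_le hi h.le,
      Maya.add_remove_comm h.ne', ← Finsupp.single_add]
    refine Eq.trans (congrArg _ ?_) (Finsupp.single_zero _)
    ring
  · by_cases hi : i ∈ S.carrier
    · simp [-Finsupp.single_mul, hi, psiStar_single, Maya.mem_remove, Maya.add_remove, Maya.numRight_remove_of_le, hsq]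
    · simp [-Finsupp.single_mul, hi, psi_single, Maya.mem_add, Maya.remove_add, Maya.numRight_add_of_le, hsq]
  · by_cases hi : i ∈ S.carrier <;> by_cases hj : j ∈ S.carrier <;>
      simp [-Finsupp.single_mul, hi, hj, psi_single, psiStar_single, Maya.mem_remove, Maya.mem_add, h.ne, h.ne']
    rw [Maya.numRight_add_of_le h.le, ← Maya.numRight_remove_of_lt hi h,
      Maya.add_remove_comm h.ne, ← Finsupp.single_add]
    refine Eq.trans (congrArg _ ?_) (Finsupp.single_zero _)
    ring

/-- `ψ_i |0⟩ = 0` for positive `i`. -/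
theorem psi_vacuum {k : ℤ} (hk : 0 < k) : psi K k (vacuum K) = 0 := by
  simp [vacuum, psi_single, Maya.vac, hk]

/-- `ψ*_i |0⟩ = 0` for negative `i`. -/
theorem psiStar_vacuum {k : ℤ} (hk : k ≤ 0) : psiStar K k (vacuum K) = 0 := by
  simp [vacuum, psiStar_single, Maya.vac, hk]

/-- `⟨0| ψ*_i = 0` for positive `i`. -/
theorem vac_psiStar {k : ℤ} (hk : 0 < k) (v : Fock K) : psiStar K k v Maya.vac = 0 := by
  classical
  induction v using Finsupp.induction_linear with
  | zero => simp
  | add f g hf hg => simp [hf, hg]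
  | single S c =>
    rw [psiStar_single]
    split_ifs with h
    · rfl
    · rw [Finsupp.single_apply, if_neg]
      intro e
      have : k ∈ Maya.vac.carrier := by rw [← e]; exact Or.inl rfl
      exact absurd this (not_le.mpr hk)

/-- `⟨0| ψ_i = 0` for negative `i`. -/
theorem vac_psi {k : ℤ} (hk : k ≤ 0) (v : Fock K) : psi K k v Maya.vac = 0 := by
  classical
  induction v using Finsupp.induction_linear with
  | zero => simp
  | add f g hf hg => simp [hf, hg]
  | single S c =>
    rw [psi_single]
    split_ifs with h
    · rw [Finsupp.single_apply, if_neg]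
      intro e
      have h1 : k ∈ Maya.vac.carrier := hk
      rw [← e] at h1
      exact h1.2 rfl
    · rfl

theorem finite_support_J (m : ℤ) (S : Maya) :
    (Function.support fun k : ℤ =>
      normalOrdered K (k - m) k (Finsupp.single S (1 : K))).Finite := by
  refine ((S.finite_particles.union (Set.finite_Ioc m 0)).union
    (S.finite_holes.image (fun k => k + m))).subset fun k hk => ?_
  rw [Function.mem_support] at hk
  unfold normalOrdered at hk
  split_ifs at hk with h
  · left
    have hkS : k ∈ S.carrier := by
      by_contra hc
      exact hk (by rw [Module.End.mul_apply, psi_single, if_neg hc, map_zero])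
    by_cases h0 : 0 < k
    · exact Or.inl ⟨hkS, h0⟩
    · exact Or.inr ⟨by linarith, not_lt.mp h0⟩
  · right
    have hkS : k - m ∉ S.carrier := by
      intro hc
      exact hk (by
        rw [LinearMap.neg_apply, Module.End.mul_apply, psiStar_single, if_pos hc, map_zero,
          neg_zero])
    exact ⟨k - m, ⟨hkS, not_lt.mp h⟩, by ring⟩

end Consistency

/-! ## Six-vertex ice

A grid with rows `n, …, 1` from top to bottom and columns `N, …, 1` from left to right.  Row `i` and
column `j` are encoded as `r : Fin n` and `c : Fin N` with `i = r + 1`, `j = c + 1`. -/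

/-- An orientation of all the edges of the grid.

* `A.up s c` says that the vertical edge in column `c + 1` at level `s` points up; level `0` is the
  bottom boundary, and level `i ≥ 1` is the northern edge of row `i`.
* `A.right r e` says that the horizontal edge of row `r + 1` at place `e` points right; place `0`
  is the right boundary, and place `j ≥ 1` is the edge to the left of column `j`. -/
@[ext] structure IceConfig (n N : ℕ) where
  up : Fin (n + 1) → Fin N → Bool
  right : Fin n → Fin (N + 1) → Bool

namespace IceConfig

variable {n N : ℕ}

/-- `IceConfig n N` as a product of function types. -/
def equivProd (n N : ℕ) :
    IceConfig n N ≃ (Fin (n + 1) → Fin N → Bool) × (Fin n → Fin (N + 1) → Bool) where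
  toFun A := (A.up, A.right)
  invFun p := ⟨p.1, p.2⟩
  left_inv _ := rfl
  right_inv _ := rfl

instance : Fintype (IceConfig n N) := Fintype.ofEquiv _ (equivProd n N).symm

/-- The edges around the vertex in row `r + 1`, column `c + 1`. -/
def leftEdge (A : IceConfig n N) (r : Fin n) (c : Fin N) : Bool := A.right r c.succ
def rightEdge (A : IceConfig n N) (r : Fin n) (c : Fin N) : Bool := A.right r c.castSucc
def topEdge (A : IceConfig n N) (r : Fin n) (c : Fin N) : Bool := A.up r.succ c
def bottomEdge (A : IceConfig n N) (r : Fin n) (c : Fin N) : Bool := A.up r.castSucc c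

/-- Exactly two of the four edges at the vertex point towards it. -/
def Balanced (A : IceConfig n N) (r : Fin n) (c : Fin N) : Prop :=
  (if A.leftEdge r c = true then 1 else 0) + (if A.rightEdge r c = false then 1 else 0) +
    (if A.topEdge r c = false then 1 else 0) + (if A.bottomEdge r c = true then 1 else 0) = 2

/-- Admissible states with top boundary given by `lam`: every vertex is balanced, the left and right
boundary edges point inward, the bottom boundary edges point down, and a top boundary edge
points up iff its column is a part of `lam`. -/
structure IsAdmissible (A : IceConfig n N) (lam : Fin n → ℕ) : Prop where
  balanced : ∀ r c, A.Balanced r c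
  left_boundary : ∀ r, A.right r (Fin.last N) = true
  right_boundary : ∀ r, A.right r 0 = false
  bottom_boundary : ∀ c, A.up 0 c = false
  top_boundary : ∀ c, A.up (Fin.last n) c = true ↔ ∃ k, lam k = (c : ℕ) + 1

end IceConfig

open Classical in
/-- The set `𝔄^λ` of admissible states, on a grid with `λ₁` columns. -/
noncomputable def iceStates {n : ℕ} [NeZero n] (lam : Fin n → ℕ) :
    Finset (IceConfig n (lam 0)) :=
  Finset.univ.filter fun A => A.IsAdmissible lam

/-- The local `Δ`-weights; the arguments say whether the left and right edges point right and
whether the top and bottom edges point up. -/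
def deltaVertex (x t : K) (left right top bottom : Bool) : K :=
  match left, right, top, bottom with
  | true, true, false, false => 1
  | false, false, true, true => t * x
  | true, true, true, true => 1
  | false, false, false, false => x
  | false, true, false, true => x * (t + 1)
  | true, false, true, false => 1
  | _, _, _, _ => 0

/-- The local `Γ`-weights. -/
def gammaVertex (x t : K) (left right top bottom : Bool) : K :=
  match left, right, top, bottom with
  | true, true, false, false => 1
  | false, false, true, true => x
  | true, true, true, true => t
  | false, false, false, false => x
  | false, true, false, true => x * (t + 1)
  | true, false, true, false => 1
  | _, _, _, _ => 0

section Weights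

variable {n N : ℕ}

/-- The `Δ`-weight of row `r + 1`; the parameters of row `i` are `x_i, t_i`. -/
def wtDeltaRow (x t : Fin n → K) (A : IceConfig n N) (r : Fin n) : K :=
  ∏ c, deltaVertex (x r) (t r)
    (A.leftEdge r c) (A.rightEdge r c) (A.topEdge r c) (A.bottomEdge r c)

/-- The `Γ`-weight of row `r + 1`; the parameters of row `i` are `x_{n-i+1}, t_{n-i+1}`. -/
def wtGammaRow (x t : Fin n → K) (A : IceConfig n N) (r : Fin n) : K :=
  ∏ c, gammaVertex (x r.rev) (t r.rev)
    (A.leftEdge r c) (A.rightEdge r c) (A.topEdge r c) (A.bottomEdge r c)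

/-- The Boltzmann weights: the products of the local weights over all vertices. -/
def wtDelta (x t : Fin n → K) (A : IceConfig n N) : K := ∏ r, wtDeltaRow x t A r
def wtGamma (x t : Fin n → K) (A : IceConfig n N) : K := ∏ r, wtGammaRow x t A r

/-- The partition functions of `𝔄^λ`. -/
noncomputable def ZDelta [NeZero n] (x t : Fin n → K) (lam : Fin n → ℕ) : K :=
  ∑ A ∈ iceStates lam, wtDelta x t A
noncomputable def ZGamma [NeZero n] (x t : Fin n → K) (lam : Fin n → ℕ) : K :=
  ∑ A ∈ iceStates lam, wtGamma x t A

end Weights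

/-! ## Strict Gelfand–Tsetlin patterns -/

/-- A strict Gelfand–Tsetlin pattern of size `n`; `row i` is the row `λ^{(i)}` with `i` entries
(and `row 0` is empty). -/
@[ext] structure StrictGTPattern (n : ℕ) where
  row : (i : ℕ) → i ≤ n → Fin i → ℕ
  strict : ∀ i hi, StrictAnti (row i hi)
  interleave : ∀ (i : ℕ) (hi : i + 1 ≤ n) (j : Fin i),
    row i (Nat.le_of_succ_le hi) j ≤ row (i + 1) hi j.castSucc ∧
      row (i + 1) hi j.succ ≤ row i (Nat.le_of_succ_le hi) j

/-- The top row `λ^{(n)}`. -/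
def StrictGTPattern.top {n : ℕ} (T : StrictGTPattern n) : Fin n → ℕ := T.row n le_rfl

/-- `A` corresponds to `T`: at each level `i`, the vertical edge in column `j` points up iff `j` is
an entry of the `i`-th row of `T`. -/
def Corresponds {n N : ℕ} (A : IceConfig n N) (T : StrictGTPattern n) : Prop :=
  ∀ (s : Fin (n + 1)) (c : Fin N),
    A.up s c = true ↔ ∃ k, T.row s (Nat.lt_succ_iff.mp s.isLt) k = (c : ℕ) + 1

end IceFock

open IceFock

/-! The currents shift creation operators, `[J_q, ψ*_a] = ψ*_{a-q}`, so conjugation by `e^{φ₊(x;t)}`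
is governed by a scalar exponential, `exp ∑ (1/q)(1 - (-t)^q)(xX)^q = (1 + txX)/(1 - xX)`
(`expSeries_logRatio`). Hence `e^{φ₊} ψ*_a = D_a e^{φ₊}` with `D_a = ψ*_a + (1 + t) ∑_{r ≥ 1} x^r
ψ*_{a-r}`, while `e^{φ₊}` fixes the vacuum of every charge.

Let `Φ_a = (1 + t) ∑_{r ≥ 0} x^{r+1} ψ*_{a-r}`, a particle in flight to the right. Then `D_{a+1} =
ψ*_{a+1} + Φ_a`, `Φ_{a+1} = x(t+1) ψ*_{a+1} + x Φ_a` and `Φ_{a+1} D_{a+1} = tx ψ*_{a+1} Φ_a`. With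
up edges read as particles in a column and left-pointing edges as a particle in flight, these are
exactly the Δ-weights of one column. Expanding a product of `D`'s column by column
(`wordOp_expansion`) thus produces row sums of Δ-ice, and such a sum has at most one nonzero term
because the horizontal edges are forced (`prod_eq_rowSum`).

The boundary factors come from the extra fermion. For Δ, `ψ_{-1/2}` passes `i` creation operators,
whence `(-1)^i`, and opens a hole at `-1/2`; only terms whose flying particle leaves the row and
fills the hole survive, with factor `x(t+1)`. For Γ the matrix element is transposed: `J_{-q}` is
adjoint to `J_q`, so it becomes one of `e^{φ₊(1/x;t)} ψ*_{λ₁+1/2}` with bra and ket exchanged. The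
dressed new particle enters the row in flight, and Δ-ice with parameter `1/x`, turned upside down,
is Γ-ice up to a gauge factor (`rowSum_delta_inv`).

In an operator product the unwanted terms of one factor die in the next (`list_prod_delta`,
`list_prod_gamma`), so the product sums over all chains of vertical edges. The bijection with
patterns is conservation of particles: to the left of a horizontal edge, consecutive levels have
numbers of up edges differing by 0 or 1. That is interleaving, and the difference determines the
edge. -/

namespace IceFock

/-! ## Exponentials of formal series -/

section Exponential

open PowerSeries Finset

variable {K : Type*} [Field K] {R : Type*} [Ring R] [Algebra K R]

/-- The exponential of a power series without constant term, over an arbitrary algebra. -/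
noncomputable def expSeries (K : Type*) [Field K] {R : Type*} [Ring R] [Algebra K R]
    (φ : PowerSeries R) : PowerSeries R :=
  PowerSeries.mk fun d : ℕ =>
    ∑ m ∈ Finset.range (d + 1), ((m.factorial : K)⁻¹) • PowerSeries.coeff d (φ ^ m)

theorem coeff_pow_eq_zero {φ : PowerSeries R} (h : coeff 0 φ = 0) {d m : ℕ} (hd : d < m) :
    coeff d (φ ^ m) = 0 := by
  have h1 : (X : PowerSeries R) ∣ φ := by
    rw [X_dvd_iff, ← coeff_zero_eq_constantCoeff_apply, h]
  obtain ⟨ψ, rfl⟩ := h1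
  -- `R` need not be commutative, but `X` is central.
  have h2 : (X * ψ) ^ m = X ^ m * ψ ^ m := (commute_X ψ).symm.mul_pow m
  rw [h2]
  exact X_pow_dvd_iff.1 (Dvd.intro _ rfl) d hd

theorem coeff_expSeries_eq_sum {φ : PowerSeries R} (h : coeff 0 φ = 0) {d M : ℕ} (hd : d < M) :
    coeff d (expSeries K φ) =
      ∑ m ∈ range M, ((m.factorial : K)⁻¹) • coeff d (φ ^ m) := by
  rw [expSeries, coeff_mk]
  refine sum_subset (range_subset_range.2 hd) fun m _ hm => ?_
  rw [coeff_pow_eq_zero h (by simpa using hm), smul_zero]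

theorem coeff_zero_expSeries (φ : PowerSeries R) : coeff 0 (expSeries K φ) = 1 := by
  simp [expSeries]

/-- Termwise `(p^m/m!)' = p' p^{m-1}/(m-1)!`, which needs `p` and `p'` to commute; hence scalar
coefficients. The term `m = 0` drops out, so `d + 2` terms become `d + 1`. -/
theorem derivative_expSeries [CharZero K] {p : PowerSeries K} (h : coeff 0 p = 0) :
    d⁄dX K (expSeries K p) = d⁄dX K p * expSeries K p := by
  ext d
  have h1 : coeff d (d⁄dX K (expSeries K p)) =
      ∑ m ∈ range (d + 2), ((m.factorial : K)⁻¹) * coeff d (d⁄dX K (p ^ m)) := by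
    rw [coeff_derivative, coeff_expSeries_eq_sum h (Nat.lt_succ_self _), sum_mul]
    refine sum_congr rfl fun m _ => ?_
    rw [coeff_derivative, smul_eq_mul, mul_assoc]
  rw [h1, sum_range_succ']
  simp only [derivative_pow, Nat.cast_zero, zero_mul, map_zero, mul_zero, add_zero]
  rw [coeff_mul]
  have h2 : ∀ x ∈ antidiagonal d, coeff x.1 (d⁄dX K p) * coeff x.2 (expSeries K p) =
      ∑ m ∈ range (d + 1), ((m.factorial : K)⁻¹) * (coeff x.1 (d⁄dX K p) * coeff x.2 (p ^ m)) := by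
    intro x hx
    rw [coeff_expSeries_eq_sum (M := d + 1) h (by have := mem_antidiagonal.1 hx; omega), mul_sum]
    refine sum_congr rfl fun m _ => ?_
    rw [smul_eq_mul]; ring
  rw [sum_congr rfl h2, sum_comm]
  refine sum_congr rfl fun m _ => ?_
  rw [← mul_sum, ← coeff_mul, Nat.add_sub_cancel, mul_comm (d⁄dX K p),
    mul_assoc]
  rw [← nsmul_eq_mul, map_nsmul, nsmul_eq_mul, ← mul_assoc]
  congr 1
  rw [Nat.factorial_succ, Nat.cast_mul, mul_inv, mul_comm, ← mul_assoc, mul_inv_cancel₀, one_mul]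
  exact Nat.cast_ne_zero.2 (Nat.succ_ne_zero m)

/-- The equation `f' = p f` expresses `(d + 1) f_{d+1}` through `f_0, …, f_d`, and `d + 1` is
invertible in characteristic 0. -/
theorem eq_of_derivative_eq_mul [CharZero K] {p f g : PowerSeries K}
    (hf : d⁄dX K f = p * f) (hg : d⁄dX K g = p * g) (h : coeff 0 f = coeff 0 g) : f = g := by
  ext d
  induction d using Nat.strong_induction_on with
  | _ d ih =>
    cases d with
    | zero => exact h
    | succ d =>
      have h1 := congrArg (coeff d) hf
      have h2 := congrArg (coeff d) hg
      rw [coeff_derivative, coeff_mul] at h1 h2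
      have h3 : ∑ x ∈ antidiagonal d, coeff x.1 p * coeff x.2 f =
          ∑ x ∈ antidiagonal d, coeff x.1 p * coeff x.2 g :=
        sum_congr rfl fun x hx => by
          rw [ih x.2 (by have := mem_antidiagonal.1 hx; omega)]
      rw [h3, ← h2] at h1
      exact mul_right_cancel₀ (Nat.cast_add_one_ne_zero d) h1

/-- The scalar series `∑_{q ≥ 1} (1/q) (1 - (-t)^q) x^q X^q`. -/
noncomputable def logRatio (x t : K) : PowerSeries K :=
  PowerSeries.mk fun q : ℕ => if q = 0 then 0 else (1 / (q : K)) * (1 - (-t) ^ q) * x ^ q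

/-- The scalar series `1 + (1 + t) ∑_{q ≥ 1} x^q X^q`. -/
noncomputable def ratio (x t : K) : PowerSeries K :=
  PowerSeries.mk fun q : ℕ => if q = 0 then 1 else (1 + t) * x ^ q

theorem derivative_ratio [CharZero K] (x t : K) :
    d⁄dX K (ratio x t) = d⁄dX K (logRatio x t) * ratio x t := by
  ext d
  rw [coeff_derivative, coeff_mul, Nat.sum_antidiagonal_eq_sum_range_succ_mk]
  have h1 : ∀ k ∈ range d.succ, coeff k (d⁄dX K (logRatio x t)) * coeff (d - k) (ratio x t) =
      x ^ (d + 1) * ((1 - (-t) ^ (k + 1)) * if d - k = 0 then 1 else 1 + t) := by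
    intro k hk
    have hk' : d + 1 = (k + 1) + (d - k) := by have := mem_range.1 hk; omega
    have hne : (k : K) + 1 ≠ 0 := Nat.cast_add_one_ne_zero k
    rw [coeff_derivative, logRatio, ratio, coeff_mk, coeff_mk, if_neg (Nat.succ_ne_zero k), hk',
      pow_add x]
    push_cast
    split_ifs with h
    · rw [h]; field_simp; simp; ring
    · field_simp; ring
  rw [sum_congr rfl h1, ← mul_sum, sum_range_succ, ratio, coeff_mk, if_neg (Nat.succ_ne_zero d)]
  have h2 : ∀ k ∈ range d, (1 - (-t) ^ (k + 1)) * (if d - k = 0 then (1 : K) else 1 + t) =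
      (1 - (-t) ^ (k + 1)) * (1 + t) := by
    intro k hk
    rw [if_neg (by have := mem_range.1 hk; omega)]
  -- The sum telescopes: `(1 + t)(-t)^{k+1} = (-t)^{k+1} - (-t)^{k+2}`. The leftover `t +
  -- (-t)^{d+1}` combines with the term `k = d` to give `(d + 1)(1 + t)`.
  have h3 : ∀ d : ℕ, ∑ k ∈ range d, (1 - (-t) ^ (k + 1)) * (1 + t) =
      d * (1 + t) + t + (-t) ^ (d + 1) := by
    intro d
    induction d with
    | zero => simp
    | succ d ih => rw [sum_range_succ, ih]; push_cast; ring
  rw [sum_congr rfl h2, h3]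
  simp
  ring

/-- Both sides solve the same first-order linear equation with constant term 1. The common value is
`(1 + txX)/(1 - xX)`. -/
theorem expSeries_logRatio [CharZero K] (x t : K) : expSeries K (logRatio x t) = ratio x t := by
  refine eq_of_derivative_eq_mul (derivative_expSeries ?_) (derivative_ratio x t) ?_
  · simp [logRatio]
  · rw [coeff_zero_expSeries]; simp [ratio]

/-- Conjugation by an exponential: if `[φ_q, s_r] = p_q s_{q+r}`, then
`e^φ s_0 = (∑_r (e^p)_r s_r) e^φ`. -/
theorem expSeries_mul_C [CharZero K] {φ : PowerSeries R} {p : PowerSeries K} {s : ℕ → R}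
    (hφ : coeff 0 φ = 0) (hp : coeff 0 p = 0)
    (hs : ∀ q r, coeff q φ * s r = coeff q p • s (q + r) + s r * coeff q φ) :
    expSeries K φ * PowerSeries.C (s 0) =
      (PowerSeries.mk fun r => coeff r (expSeries K p) • s r) * expSeries K φ := by
  -- `Θ` transports scalar series to operator series; by `hs`, the commutator with `φ` acts on its
  -- image as multiplication by `p`.
  let Θ : PowerSeries K → PowerSeries R := fun f => PowerSeries.mk fun r => coeff r f • s r
  have hΘ : ∀ f, φ * Θ f = Θ (p * f) + Θ f * φ := by
    intro f
    ext d
    simp only [Θ, map_add, coeff_mul, coeff_mk, mul_smul_comm, hs, smul_add, sum_add_distrib]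
    congr 1
    · rw [sum_smul]
      refine sum_congr rfl fun a ha => ?_
      rw [mem_antidiagonal.1 ha, smul_smul, mul_comm]
    · rw [← Nat.sum_antidiagonal_swap]
      exact sum_congr rfl fun a _ => by simp
  -- `L - N` is `ad φ`. It commutes with `N`, so the binomial theorem for `L = (L - N) + N` moves
  -- `φ^m` past `Θ 1`.
  let L : Module.End ℤ (PowerSeries R) := LinearMap.mulLeft ℤ φ
  let N : Module.End ℤ (PowerSeries R) := LinearMap.mulRight ℤ φ
  have hLN : Commute L N := LinearMap.commute_mulLeft_right φ φ
  have had : ∀ k f, ((L - N) ^ k) (Θ f) = Θ (p ^ k * f) := by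
    intro k
    induction k with
    | zero => intro f; simp
    | succ k ih =>
      intro f
      rw [pow_succ, Module.End.mul_apply]
      have : (L - N) (Θ f) = Θ (p * f) := by
        simp [L, N, hΘ]
      rw [this, ih, pow_succ, mul_assoc]
  have hpow : ∀ m, φ ^ m * Θ 1 =
      ∑ a ∈ antidiagonal m, m.choose a.1 • (Θ (p ^ a.1) * φ ^ a.2) := by
    intro m
    have h1 : (L ^ m) (Θ 1) = (((L - N) + N) ^ m) (Θ 1) := by rw [sub_add_cancel]
    have hc : Commute N (L - N) := hLN.symm.sub_right (Commute.refl N)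
    rw [add_comm, hc.add_pow', LinearMap.sum_apply] at h1
    rw [LinearMap.pow_mulLeft, LinearMap.mulLeft_apply] at h1
    rw [h1, ← Nat.sum_antidiagonal_swap]
    refine sum_congr rfl fun a ha => ?_
    rw [LinearMap.smul_apply, Module.End.mul_apply, had, mul_one, LinearMap.pow_mulRight,
      LinearMap.mulRight_apply]
    simp only [Prod.snd_swap, Prod.fst_swap]
    rw [← mem_antidiagonal.1 ha, Nat.choose_symm_add]
  have hC : Θ 1 = PowerSeries.C (s 0) := by
    ext d
    simp only [Θ, coeff_mk, coeff_C, coeff_one]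
    split_ifs with h
    · rw [h, one_smul]
    · rw [zero_smul]
  rw [← hC]
  change _ = Θ (expSeries K p) * _
  ext d
  set F : ℕ → ℕ → R := fun k l =>
    ((k.factorial : K)⁻¹ * (l.factorial : K)⁻¹) • coeff d (Θ (p ^ k) * φ ^ l) with hF
  have hF0 : ∀ k l, d < k + l → F k l = 0 := by
    intro k l hkl
    simp only [hF]
    rw [coeff_mul, sum_eq_zero, smul_zero]
    intro a ha
    have ha' := mem_antidiagonal.1 ha
    by_cases h : a.1 < k
    · simp only [Θ, coeff_mk]; rw [coeff_pow_eq_zero hp h, zero_smul, zero_mul]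
    · rw [coeff_pow_eq_zero hφ (by omega), mul_zero]
  have hl : coeff d (expSeries K φ * Θ 1) =
      ∑ m ∈ range (d + 1), ∑ k ∈ range (m + 1), F k (m - k) := by
    have : coeff d (expSeries K φ * Θ 1) =
        ∑ m ∈ range (d + 1), ((m.factorial : K)⁻¹) • coeff d (φ ^ m * Θ 1) := by
      simp only [coeff_mul, smul_sum]
      rw [sum_comm]
      refine sum_congr rfl fun a ha => ?_
      rw [coeff_expSeries_eq_sum (M := d + 1) hφ (by have := mem_antidiagonal.1 ha; omega),
        sum_mul]
      exact sum_congr rfl fun m _ => smul_mul_assoc _ _ _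
    rw [this]
    refine sum_congr rfl fun m _ => ?_
    rw [hpow, map_sum, smul_sum, ← Nat.sum_antidiagonal_eq_sum_range_succ F]
    refine sum_congr rfl fun a ha => ?_
    have ha' := mem_antidiagonal.1 ha
    simp only [hF]
    rw [map_nsmul, ← Nat.cast_smul_eq_nsmul K, smul_smul]
    congr 1
    have h1 : ((m.choose a.1 : ℕ) : K) * a.1.factorial * a.2.factorial = m.factorial := by
      rw [← ha']
      rw [Nat.choose_symm_add]
      exact_mod_cast Nat.add_choose_mul_factorial_mul_factorial a.1 a.2
    have hm : (m.factorial : K) ≠ 0 := Nat.cast_ne_zero.2 m.factorial_ne_zero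
    have hk : (a.1.factorial : K) ≠ 0 := Nat.cast_ne_zero.2 a.1.factorial_ne_zero
    have hl : (a.2.factorial : K) ≠ 0 := Nat.cast_ne_zero.2 a.2.factorial_ne_zero
    field_simp
    rw [← h1]
  have hr : coeff d (Θ (expSeries K p) * expSeries K φ) =
      ∑ k ∈ range (d + 1), ∑ l ∈ range (d + 1), F k l := by
    rw [coeff_mul]
    have : ∀ a ∈ antidiagonal d, coeff a.1 (Θ (expSeries K p)) * coeff a.2 (expSeries K φ) =
        ∑ k ∈ range (d + 1), ∑ l ∈ range (d + 1),
          ((k.factorial : K)⁻¹ * (l.factorial : K)⁻¹) •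
            (coeff a.1 (Θ (p ^ k)) * coeff a.2 (φ ^ l)) := by
      intro a ha
      simp only [Θ, coeff_mk]
      rw [coeff_expSeries_eq_sum (M := d + 1) hφ (by have := mem_antidiagonal.1 ha; omega),
        coeff_expSeries_eq_sum (M := d + 1) hp (by have := mem_antidiagonal.1 ha; omega),
        sum_smul, sum_mul_sum]
      refine sum_congr rfl fun k _ => sum_congr rfl fun l _ => ?_
      rw [smul_eq_mul, mul_smul_comm, mul_comm, ← smul_smul, mul_smul, smul_mul_assoc,
        smul_mul_assoc, smul_comm]
      simp only [smul_mul_assoc, smul_smul]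
      congr 1; ring
    rw [sum_congr rfl this, sum_comm]
    refine sum_congr rfl fun k _ => ?_
    rw [sum_comm]
    refine sum_congr rfl fun l _ => ?_
    simp only [hF]
    rw [coeff_mul, smul_sum]
  -- The left side runs over the triangle `k + l ≤ d`, the right side over the square `k, l ≤ d`.
  -- The extra terms vanish because neither `p` nor `φ` has a constant term.
  rw [hl, hr, sum_range_diag_flip (d + 1) F]
  refine sum_congr rfl fun k _ => sum_subset (range_subset_range.2 (Nat.sub_le _ _)) fun l _ h => ?_
  exact hF0 _ _ (by simp at h; omega)

end Exponential

/-! ## Currents -/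

section Currents

variable {K : Type*} [Field K]

theorem normalOrdered_of_ne {i j : ℤ} (h : i ≠ j) :
    normalOrdered K i j = psiStar K i * psi K j := by
  unfold normalOrdered
  split_ifs
  · rfl
  · have := psi_psiStar_anticomm K j i
    rw [if_neg h.symm] at this
    exact LinearMap.ext fun v => neg_eq_of_add_eq_zero_right (LinearMap.congr_fun this v)

theorem finite_support_current (m : ℤ) (v : Fock K) :
    (Function.support fun k : ℤ => normalOrdered K (k - m) k v).Finite := by
  induction v using Finsupp.induction_linear with
  | zero => simp
  | add f g hf hg =>
    refine (hf.union hg).subset ?_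
    simp only [map_add]
    exact Function.support_add _ _
  | single S c =>
    have : (fun k : ℤ => normalOrdered K (k - m) k (Finsupp.single S c)) =
        fun k : ℤ => c • normalOrdered K (k - m) k (Finsupp.single S 1) := by
      funext k
      rw [← map_smul, Finsupp.smul_single, smul_eq_mul, mul_one]
    rw [this]
    exact (finite_support_J K m S).subset fun k hk h => hk (by simp only at h; simp only [h, smul_zero])

theorem J_apply (m : ℤ) (v : Fock K) : J K m v = ∑ᶠ k : ℤ, normalOrdered K (k - m) k v := by
  induction v using Finsupp.induction_linear with
  | zero => simp
  | add f g hf hg =>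
    simp only [map_add]
    rw [hf, hg, finsum_add_distrib (finite_support_current m f) (finite_support_current m g)]
  | single S c =>
    have : (fun k : ℤ => normalOrdered K (k - m) k (Finsupp.single S c)) =
        fun k : ℤ => c • normalOrdered K (k - m) k (Finsupp.single S 1) := by
      funext k
      rw [← map_smul, Finsupp.smul_single, smul_eq_mul, mul_one]
    rw [this, ← smul_finsum' c (finite_support_J K m S)]
    simp [J]

theorem J_apply_of_ne {m : ℤ} (hm : m ≠ 0) (v : Fock K) :
    J K m v = ∑ᶠ k : ℤ, psiStar K (k - m) (psi K k v) := by
  rw [J_apply]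
  refine finsum_congr fun k => ?_
  rw [normalOrdered_of_ne (by omega), Module.End.mul_apply]

theorem finite_support_hop {m : ℤ} (hm : m ≠ 0) (v : Fock K) :
    (Function.support fun k : ℤ => psiStar K (k - m) (psi K k v)).Finite := by
  refine (finite_support_current m v).subset fun k hk => ?_
  rwa [Function.mem_support, normalOrdered_of_ne (by omega), Module.End.mul_apply]

/-- `[J_m, ψ*_a] = ψ*_{a-m}` for `m ≠ 0`. -/
theorem J_mul_psiStar {m : ℤ} (hm : m ≠ 0) (a : ℤ) :
    J K m * psiStar K a = psiStar K (a - m) + psiStar K a * J K m := by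
  refine LinearMap.ext fun v => ?_
  -- Moving `ψ*_a` to the left past `ψ_k` and then past `ψ*_{k-m}` costs two signs, which cancel,
  -- and leaves a contraction only at `k = a`.
  have h1 : ∀ k, psiStar K (k - m) (psi K k (psiStar K a v)) =
      (if k = a then psiStar K (a - m) v else 0) +
        psiStar K a (psiStar K (k - m) (psi K k v)) := by
    intro k
    have e1 := LinearMap.congr_fun (psi_psiStar_anticomm K k a) v
    have e2 := LinearMap.congr_fun (psiStar_anticomm K (k - m) a) (psi K k v)
    simp only [LinearMap.add_apply, Module.End.mul_apply, LinearMap.zero_apply] at e1 e2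
    rw [eq_sub_of_add_eq e1, map_sub, ← neg_eq_of_add_eq_zero_left e2]
    split_ifs with h
    · subst h; simp
    · simp
  rw [LinearMap.add_apply, Module.End.mul_apply, Module.End.mul_apply, J_apply_of_ne hm,
    J_apply_of_ne hm, finsum_congr h1, finsum_add_distrib]
  · congr 1
    · rw [finsum_eq_single _ a fun k hk => if_neg hk, if_pos rfl]
    · exact ((psiStar K a).toAddMonoidHom.map_finsum (finite_support_hop hm v)).symm
  · refine (Set.finite_singleton a).subset fun k hk => ?_
    by_contra h
    exact hk (if_neg h)
  · refine (finite_support_hop hm v).subset fun k hk h => hk ?_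
    simp only at h
    simp only [h, map_zero]

/-- The vacuum of charge `b`: exactly the positions `k ≤ b` are occupied. -/
def vacAt (b : ℤ) : Maya where
  carrier := {k | k ≤ b}
  finite_particles := by
    refine (Set.finite_Ioc 0 b).subset ?_
    rintro k ⟨h, hk⟩
    exact ⟨hk, h⟩
  finite_holes := by
    refine (Set.finite_Ioc b 0).subset ?_
    rintro k ⟨h, hk⟩
    exact ⟨not_le.1 h, hk⟩

/-- The vacuum vector of charge `b`. -/
noncomputable def vacVec (K : Type*) [Field K] (b : ℤ) : Fock K := Finsupp.single (vacAt b) 1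

theorem psiStar_vacVec {k b : ℤ} (hk : k ≤ b) : psiStar K k (vacVec K b) = 0 := by
  simp [vacVec, psiStar_single, vacAt, hk]

theorem psi_vacVec {k b : ℤ} (hk : b < k) : psi K k (vacVec K b) = 0 := by
  simp [vacVec, psi_single, vacAt, hk]

theorem numRight_vacAt (b : ℤ) : (vacAt b).numRight b = 0 := by
  unfold Maya.numRight
  rw [Set.ncard_eq_zero ((vacAt b).finite_right b)]
  ext j
  simp [vacAt]

theorem psi_vacVec_self (b : ℤ) : psi K b (vacVec K b) = vacVec K (b - 1) := by
  rw [vacVec, psi_single, if_pos (by simp [vacAt]), numRight_vacAt, vacVec]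
  congr 1
  · ext k
    simp only [Maya.remove, vacAt, Set.mem_sdiff, Set.mem_singleton_iff, Set.mem_ofPred_eq]
    omega
  · simp

theorem psiStar_vacVec_succ (b : ℤ) : psiStar K b (vacVec K (b - 1)) = vacVec K b := by
  have h := LinearMap.congr_fun (psi_psiStar_anticomm K b b) (vacVec K b)
  rw [if_pos rfl, LinearMap.add_apply, Module.End.mul_apply, Module.End.mul_apply,
    psiStar_vacVec le_rfl, map_zero, zero_add, psi_vacVec_self] at h
  exact h

/-- `J_q` kills the vacua for `q > 0`. -/
theorem J_vacVec {m : ℤ} (hm : 0 < m) (b : ℤ) : J K m (vacVec K b) = 0 := by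
  rw [J_apply_of_ne hm.ne']
  refine finsum_eq_zero_of_forall_eq_zero fun k => ?_
  by_cases hk : b < k
  · rw [psi_vacVec hk, map_zero]
  -- For `k ≤ b` the target `k - m < k` is already occupied, so the hop is excluded.
  · have e := LinearMap.congr_fun (psi_psiStar_anticomm K k (k - m)) (vacVec K b)
    rw [if_neg (by omega), LinearMap.add_apply, Module.End.mul_apply, Module.End.mul_apply,
      psiStar_vacVec (by omega), map_zero, zero_add] at e
    exact e

end Currents

/-! ## Adjoint operators -/

section Adjoint

variable {K : Type*} [Field K]

/-- The bilinear form for which the configurations are orthonormal. -/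
noncomputable def pairing (v w : Fock K) : K := v.sum fun S c => c * w S

theorem pairing_single (S : Maya) (c : K) (w : Fock K) :
    pairing (Finsupp.single S c) w = c * w S := by
  rw [pairing, Finsupp.sum_single_index (zero_mul _)]

theorem pairing_add_left (v v' w : Fock K) : pairing (v + v') w = pairing v w + pairing v' w := by
  classical
  exact Finsupp.sum_add_index' (fun _ => zero_mul _) fun _ _ _ => add_mul _ _ _

theorem pairing_zero_left (w : Fock K) : pairing 0 w = 0 := Finsupp.sum_zero_index

theorem pairing_add_right (v w w' : Fock K) : pairing v (w + w') = pairing v w + pairing v w' := by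
  simp [pairing, mul_add, Finsupp.sum_add]

theorem pairing_smul_left (c : K) (v w : Fock K) : pairing (c • v) w = c * pairing v w := by
  induction v using Finsupp.induction_linear with
  | zero => simp [pairing_zero_left]
  | add f g hf hg => rw [smul_add, pairing_add_left, pairing_add_left, hf, hg, mul_add]
  | single S a => rw [Finsupp.smul_single, pairing_single, pairing_single, smul_eq_mul, mul_assoc]

theorem pairing_comm (v w : Fock K) : pairing v w = pairing w v := by
  classical
  induction v using Finsupp.induction_linear with
  | zero => simp [pairing]
  | add f g hf hg => rw [pairing_add_left, pairing_add_right, hf, hg]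
  | single S a =>
    induction w using Finsupp.induction_linear with
    | zero => simp [pairing]
    | add f g hf hg => rw [pairing_add_left, pairing_add_right, hf, hg]
    | single S' a' =>
      rw [pairing_single, pairing_single, Finsupp.single_apply, Finsupp.single_apply]
      by_cases h : S = S'
      · simp [h, mul_comm]
      · simp [h, Ne.symm h]

theorem pairing_smul_right (c : K) (v w : Fock K) : pairing v (c • w) = c * pairing v w := by
  rw [pairing_comm, pairing_smul_left, pairing_comm]

/-- `A` and `B` are adjoint to each other for the bilinear form `pairing`. -/
def IsAdj (A B : Module.End K (Fock K)) : Prop := ∀ v w, pairing (A v) w = pairing v (B w)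

theorem IsAdj.symm {A B : Module.End K (Fock K)} (h : IsAdj A B) : IsAdj B A := fun v w => by
  rw [pairing_comm, ← h, pairing_comm]

theorem IsAdj.mul {A B A' B' : Module.End K (Fock K)} (h : IsAdj A B) (h' : IsAdj A' B') :
    IsAdj (A * A') (B' * B) := fun v w => by
  rw [Module.End.mul_apply, Module.End.mul_apply, h, h']

theorem IsAdj.smul {A B : Module.End K (Fock K)} (h : IsAdj A B) (c : K) :
    IsAdj (c • A) (c • B) := fun v w => by
  rw [LinearMap.smul_apply, LinearMap.smul_apply, pairing_smul_left, pairing_smul_right, h]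

theorem IsAdj.one : IsAdj (1 : Module.End K (Fock K)) 1 := fun _ _ => rfl

theorem IsAdj.zero : IsAdj (0 : Module.End K (Fock K)) 0 := fun v w => by
  rw [LinearMap.zero_apply, LinearMap.zero_apply, pairing_zero_left, pairing_comm,
    pairing_zero_left]

theorem IsAdj.sum {ι : Type*} {s : Finset ι} {A B : ι → Module.End K (Fock K)}
    (h : ∀ i ∈ s, IsAdj (A i) (B i)) : IsAdj (∑ i ∈ s, A i) (∑ i ∈ s, B i) := by
  classical
  induction s using Finset.induction_on with
  | empty => simpa using IsAdj.zero
  | insert a s ha ih =>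
    intro v w
    rw [Finset.sum_insert ha, Finset.sum_insert ha, LinearMap.add_apply, LinearMap.add_apply,
      pairing_add_left, pairing_add_right, h a (Finset.mem_insert_self _ _),
      ih fun i hi => h i (Finset.mem_insert_of_mem hi)]

theorem IsAdj.list_prod {ι : Type*} (l : List ι) {A B : ι → Module.End K (Fock K)}
    (h : ∀ i, IsAdj (A i) (B i)) : IsAdj (l.map A).prod (l.map B).reverse.prod := by
  induction l with
  | nil => exact IsAdj.one
  | cons a l ih =>
    simp only [List.map_cons, List.prod_cons, List.reverse_cons, List.prod_append, List.prod_nil,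
      mul_one]
    exact (h a).mul ih

theorem isAdj_of_single {A B : Module.End K (Fock K)}
    (h : ∀ S S', A (Finsupp.single S 1) S' = B (Finsupp.single S' 1) S) : IsAdj A B := by
  intro v w
  have key : ∀ S S' c c', pairing (A (Finsupp.single S c)) (Finsupp.single S' c') =
      pairing (Finsupp.single S c) (B (Finsupp.single S' c')) := by
    intro S S' c c'
    have e : ∀ (S : Maya) (c : K), Finsupp.single S c = c • Finsupp.single S (1 : K) := by
      intro S c; rw [Finsupp.smul_single, smul_eq_mul, mul_one]
    rw [pairing_single, pairing_comm, pairing_single, e S c, e S' c', map_smul, map_smul,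
      Finsupp.smul_apply, Finsupp.smul_apply, h, smul_eq_mul, smul_eq_mul]
    ring
  induction v using Finsupp.induction_linear with
  | zero => simp [pairing_zero_left]
  | add f g hf hg => rw [map_add, pairing_add_left, pairing_add_left, hf, hg]
  | single S c =>
    induction w using Finsupp.induction_linear with
    | zero => rw [map_zero, pairing_comm, pairing_zero_left, pairing_comm, pairing_zero_left]
    | add f g hf hg => rw [map_add, pairing_add_right, pairing_add_right, hf, hg]
    | single S' c' => exact key S S' c c'

/-- Adding or removing a particle at `k` does not change the number of particles strictly to the
right of `k`, so both operators carry the same sign. -/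
theorem isAdj_psi_psiStar (k : ℤ) : IsAdj (psi K k) (psiStar K k) := by
  classical
  refine isAdj_of_single fun S S' => ?_
  rw [psi_single, psiStar_single, mul_one, mul_one]
  by_cases h : k ∈ S.carrier <;> by_cases h' : k ∈ S'.carrier
  · rw [if_pos h, if_pos h', Finsupp.single_apply, if_neg, Finsupp.zero_apply]
    rintro rfl
    exact h'.2 rfl
  · rw [if_pos h, if_neg h', Finsupp.single_apply, Finsupp.single_apply]
    by_cases e : S.remove k = S'
    · have e' : S'.add k = S := by rw [← e, Maya.add_remove h]
      rw [if_pos e, if_pos e', ← e, Maya.numRight_remove_of_le h le_rfl]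
    · rw [if_neg e, if_neg]
      rintro rfl
      exact e (Maya.remove_add h')
  · rw [if_neg h, if_pos h']; rfl
  · rw [if_neg h, if_neg h', Finsupp.single_apply, if_neg, Finsupp.zero_apply]
    rintro rfl
    exact h (Or.inl rfl)

/-- Transposition turns the hop `ψ*_{k-m} ψ_k` into `ψ*_k ψ_{k-m}`; reindexing by `k ↦ k - m` gives
the sum for `J_{-m}`. -/
theorem isAdj_J {m : ℤ} (hm : m ≠ 0) : IsAdj (J K m) (J K (-m)) := by
  intro v w
  have hadd : ∀ u : Fock K, ∃ f : Fock K →+ K, ∀ v, f v = pairing u v := fun u =>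
    ⟨⟨⟨pairing u, by rw [pairing_comm, pairing_zero_left]⟩, pairing_add_right u⟩, fun _ => rfl⟩
  obtain ⟨f, hf⟩ := hadd w
  obtain ⟨g, hg⟩ := hadd v
  rw [J_apply_of_ne hm, J_apply_of_ne (neg_ne_zero.2 hm), pairing_comm, ← hf, ← hg,
    f.map_finsum (finite_support_hop hm v),
    g.map_finsum (finite_support_hop (neg_ne_zero.2 hm) w)]
  refine finsum_eq_of_bijective (fun k => k - m) ⟨fun a b h => by simpa using h,
    fun b => ⟨b + m, by simp⟩⟩ fun k => ?_
  rw [hf, hg, pairing_comm, (isAdj_psi_psiStar (k - m)).symm, isAdj_psi_psiStar, sub_neg_eq_add,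
    sub_add_cancel]

/-- Coefficientwise adjointness of formal sums of operators. -/
def IsAdjSeries (A B : OpSeries K) : Prop :=
  ∀ d, IsAdj (PowerSeries.coeff d A) (PowerSeries.coeff d B)

theorem IsAdjSeries.mul {A B A' B' : OpSeries K} (h : IsAdjSeries A B) (h' : IsAdjSeries A' B') :
    IsAdjSeries (A * A') (B' * B) := fun d => by
  rw [PowerSeries.coeff_mul, PowerSeries.coeff_mul, ← Finset.Nat.sum_antidiagonal_swap]
  exact IsAdj.sum fun a _ => (h _).mul (h' _)

theorem isAdjSeries_op {A B : Module.End K (Fock K)} (h : IsAdj A B) :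
    IsAdjSeries (op A) (op B) := fun d => by
  simp only [op, PowerSeries.coeff_C]
  split_ifs
  · exact h
  · exact IsAdj.zero

theorem IsAdjSeries.one : IsAdjSeries (1 : OpSeries K) 1 := by
  simpa [op] using isAdjSeries_op (IsAdj.one (K := K))

theorem IsAdjSeries.pow {A B : OpSeries K} (h : IsAdjSeries A B) (m : ℕ) :
    IsAdjSeries (A ^ m) (B ^ m) := by
  induction m with
  | zero => simpa using IsAdjSeries.one
  | succ m ih => rw [pow_succ, pow_succ']; exact ih.mul h

theorem IsAdjSeries.expOp {A B : OpSeries K} (h : IsAdjSeries A B) :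
    IsAdjSeries (expOp A) (expOp B) := fun d => by
  simp only [IceFock.expOp, PowerSeries.coeff_mk]
  exact IsAdj.sum fun m _ => (h.pow m d).smul _

theorem IsAdjSeries.list_prod {ι : Type*} (l : List ι) {A B : ι → OpSeries K}
    (h : ∀ i, IsAdjSeries (A i) (B i)) : IsAdjSeries (l.map A).prod (l.map B).reverse.prod := by
  induction l with
  | nil => exact IsAdjSeries.one
  | cons a l ih =>
    simp only [List.map_cons, List.prod_cons, List.reverse_cons, List.prod_append, List.prod_nil,
      mul_one]
    exact (h a).mul ih

/-- The series `e^{φ₋}` raises the energy, and infinitely many of its terms may act nontrivially on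
one vector. Its matrix elements are therefore computed through its adjoint, which lowers the energy.
-/
theorem isAdjSeries_phi (x t : K) : IsAdjSeries (phiMinus x t) (phiPlus x⁻¹ t) := fun d => by
  simp only [phiMinus, phiPlus, PowerSeries.coeff_mk]
  split_ifs with h
  · exact IsAdj.zero
  · refine IsAdj.smul ?_ _
    have := isAdj_J (K := K) (m := -(d : ℤ)) (by omega)
    rwa [neg_neg] at this

theorem bra_eq_pairing {m : ℕ} (mu : Fin m → ℕ) (v : Fock K) : bra mu v = pairing (ket mu) v := by
  have h := IsAdj.list_prod (List.finRange m) fun i => (isAdj_psi_psiStar (K := K) (mu i : ℤ)).symm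
  rw [bra, ket, List.ofFn_eq_map, List.ofFn_eq_map, h, vacuum, pairing_single, one_mul]

theorem braket_adjoint {m n : ℕ} (mu : Fin m → ℕ) (lam : Fin n → ℕ) {A B : OpSeries K}
    (h : IsAdjSeries A B) : braket mu A lam = braket lam B mu := by
  refine finsum_congr fun d => ?_
  rw [bra_eq_pairing, bra_eq_pairing, pairing_comm, h, pairing_comm, pairing_comm]

end Adjoint

/-! ## Locally finite formal sums -/

section LocallyFinite

open Finset

variable {K : Type*} [Field K]

/-- Only finitely many terms of `A` act non-trivially on `v`. -/
def FiniteAt (A : OpSeries K) (v : Fock K) : Prop :=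
  ∃ D, ∀ d, D ≤ d → PowerSeries.coeff d A v = 0

/-- The formal sum `A` acts as the operator `B`: on each vector only finitely many terms contribute,
and they add up to the value of `B`. -/
def SumsTo (A : OpSeries K) (B : Module.End K (Fock K)) : Prop :=
  ∀ v, ∃ D, ∀ M, D ≤ M → ∑ d ∈ range M, PowerSeries.coeff d A v = B v

theorem SumsTo.finiteAt {A : OpSeries K} {B : Module.End K (Fock K)} (h : SumsTo A B)
    (v : Fock K) : FiniteAt A v := by
  obtain ⟨D, hD⟩ := h v
  refine ⟨D, fun d hd => ?_⟩
  have h1 := hD (d + 1) (by omega)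
  rw [sum_range_succ, hD d hd] at h1
  exact add_eq_left.1 h1

theorem SumsTo.unique {A : OpSeries K} {B B' : Module.End K (Fock K)} (h : SumsTo A B)
    (h' : SumsTo A B') : B = B' := by
  refine LinearMap.ext fun v => ?_
  obtain ⟨D, hD⟩ := h v
  obtain ⟨D', hD'⟩ := h' v
  rw [← hD (max D D') (le_max_left _ _), hD' _ (le_max_right _ _)]

theorem SumsTo.finsum {A : OpSeries K} {B : Module.End K (Fock K)} (h : SumsTo A B)
    (f : Fock K →+ K) (v : Fock K) : ∑ᶠ d : ℕ, f (PowerSeries.coeff d A v) = f (B v) := by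
  obtain ⟨D, hD⟩ := h v
  obtain ⟨D', hD'⟩ := h.finiteAt v
  rw [← hD (max D D') (le_max_left _ _), map_sum]
  refine finsum_eq_sum_of_support_subset _ fun d hd => ?_
  by_contra hc
  simp only [coe_range, Set.mem_Iio, not_lt] at hc
  exact hd (by simp only; rw [hD' d ((le_max_right _ _).trans hc), map_zero])

theorem exists_sumsTo {A : OpSeries K} (h : ∀ v, FiniteAt A v) :
    ∃ B, SumsTo A B := by
  choose D hD using h
  have key : ∀ v M, D v ≤ M → ∑ d ∈ range M, PowerSeries.coeff d A v =
      ∑ d ∈ range (D v), PowerSeries.coeff d A v := by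
    intro v M hM
    refine (sum_subset (range_subset_range.2 hM) fun d _ hd => hD v d ?_).symm
    simpa using hd
  refine ⟨⟨⟨fun v => ∑ d ∈ range (D v), PowerSeries.coeff d A v, fun v w => ?_⟩, fun c v => ?_⟩,
    fun v => ⟨D v, key v⟩⟩
  · rw [← key v (D v + D w + D (v + w)) (by omega), ← key w (D v + D w + D (v + w)) (by omega),
      ← key (v + w) (D v + D w + D (v + w)) (by omega), ← sum_add_distrib]
    exact sum_congr rfl fun d _ => map_add _ _ _
  · rw [RingHom.id_apply]
    change ∑ d ∈ range (D (c • v)), PowerSeries.coeff d A (c • v) =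
      c • ∑ d ∈ range (D v), PowerSeries.coeff d A v
    rw [← key v (D v + D (c • v)) (by omega), ← key (c • v) (D v + D (c • v)) (by omega), smul_sum]
    exact sum_congr rfl fun d _ => map_smul _ _ _

theorem FiniteAt.mul {A A' : OpSeries K} {v : Fock K} (h : ∀ w, FiniteAt A w)
    (h' : FiniteAt A' v) : FiniteAt (A * A') v := by
  choose D hD using h
  obtain ⟨D', hD'⟩ := h'
  let E := ∑ q ∈ range D', D (PowerSeries.coeff q A' v)
  refine ⟨E + D', fun d hd => ?_⟩
  rw [PowerSeries.coeff_mul, LinearMap.sum_apply]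
  refine sum_eq_zero fun a ha => ?_
  have ha' := mem_antidiagonal.1 ha
  rw [Module.End.mul_apply]
  by_cases hq : a.2 < D'
  · refine hD _ _ ?_
    have : D (PowerSeries.coeff a.2 A' v) ≤ E :=
      single_le_sum (f := fun q => D (PowerSeries.coeff q A' v)) (fun _ _ => Nat.zero_le _)
        (mem_range.2 hq)
    omega
  · rw [hD' _ (not_lt.1 hq), map_zero]

theorem SumsTo.mul {A A' : OpSeries K} {B B' : Module.End K (Fock K)} (h : SumsTo A B)
    (h' : SumsTo A' B') : SumsTo (A * A') (B * B') := by
  intro v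
  have hf := h.finiteAt
  choose D hD using h
  choose F hF using hf
  obtain ⟨D', hD'⟩ := h' v
  obtain ⟨F', hF'⟩ := h'.finiteAt v
  -- On `v`, only finitely many terms of `A'` matter; `E` bounds the number of terms of `A` needed
  -- on every one of the resulting vectors.
  let E := ∑ q ∈ range (D' + F'), D (PowerSeries.coeff q A' v)
  refine ⟨E + D' + F', fun M hM => ?_⟩
  have h1 : ∀ d, PowerSeries.coeff d (A * A') v = ∑ k ∈ range (d + 1),
      PowerSeries.coeff (d - k) A (PowerSeries.coeff k A' v) := by
    intro d
    rw [PowerSeries.coeff_mul, LinearMap.sum_apply, ← Nat.sum_antidiagonal_swap,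
      Nat.sum_antidiagonal_eq_sum_range_succ_mk]
    rfl
  simp only [h1]
  rw [sum_range_diag_flip M fun k l => PowerSeries.coeff l A (PowerSeries.coeff k A' v),
    Module.End.mul_apply, ← hD' (D' + F') (by omega), map_sum]
  have h2 : ∀ q ∈ range M, q ∉ range (D' + F') →
      ∑ k ∈ range (M - q), PowerSeries.coeff k A (PowerSeries.coeff q A' v) = 0 := by
    intro q _ hq
    refine sum_eq_zero fun k _ => ?_
    rw [hF' q (by simp at hq; omega), map_zero]
  rw [← sum_subset (range_subset_range.2 (by omega)) h2]
  refine sum_congr rfl fun q hq => ?_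
  have h3 : D (PowerSeries.coeff q A' v) ≤ E :=
    single_le_sum (f := fun q => D (PowerSeries.coeff q A' v)) (fun _ _ => Nat.zero_le _) hq
  have h4 := mem_range.1 hq
  by_cases hq0 : q < F'
  · exact hD _ _ (by omega)
  · rw [hF' q (by omega)]
    simp

theorem sumsTo_op (A : Module.End K (Fock K)) : SumsTo (op A) A := fun v =>
  ⟨1, fun M hM => by
    obtain ⟨M, rfl⟩ := Nat.exists_eq_add_of_le' hM
    rw [sum_range_succ']
    simp [op, PowerSeries.coeff_C]⟩

theorem SumsTo.one : SumsTo (1 : OpSeries K) 1 := by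
  simpa [op] using sumsTo_op (1 : Module.End K (Fock K))

theorem SumsTo.list_prod {ι : Type*} (l : List ι) {A : ι → OpSeries K}
    {B : ι → Module.End K (Fock K)} (h : ∀ i, SumsTo (A i) (B i)) :
    SumsTo (l.map A).prod (l.map B).prod := by
  induction l with
  | nil => exact SumsTo.one
  | cons a l ih => exact (h a).mul ih

end LocallyFinite

/-! ## The half vertex operators `e^{φ₊(x;t)}` -/

section HalfVertex

open Finset

variable {K : Type*} [Field K]

theorem exists_forall_le_mem (S : Maya) : ∃ b : ℤ, (∀ k ≤ b, k ∈ S.carrier) := by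
  obtain ⟨b, hb⟩ := S.finite_holes.bddBelow
  refine ⟨min (b - 1) 0, fun k hk => ?_⟩
  by_contra h
  have := hb ⟨h, hk.trans (min_le_right _ _)⟩
  have := min_le_left (b - 1) 0
  omega

/-- Fock space is spanned by the vectors obtained from the vacua by creation operators. -/
theorem fock_induction {P : Fock K → Prop} (hvac : ∀ b, P (vacVec K b))
    (hstar : ∀ a v, P v → P (psiStar K a v)) (hadd : ∀ v w, P v → P w → P (v + w))
    (hsmul : ∀ (c : K) v, P v → P (c • v)) (v : Fock K) : P v := by
  -- Below a suitable level `b` everything is occupied; the induction is on the number of particles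
  -- above it.
  have key : ∀ (n : ℕ) (b : ℤ) (S : Maya), (∀ k ≤ b, k ∈ S.carrier) →
      {j | j ∈ S.carrier ∧ b < j}.ncard = n → P (Finsupp.single S 1) := by
    intro n
    induction n with
    | zero =>
      intro b S hb hn
      rw [Set.ncard_eq_zero (S.finite_right b)] at hn
      have : S = vacAt b := by
        ext k
        refine ⟨fun hk => ?_, hb k⟩
        by_contra h
        have : k ∈ {j | j ∈ S.carrier ∧ b < j} := ⟨hk, not_le.1 h⟩
        rw [hn] at this
        exact this
      rw [this]
      exact hvac b
    | succ n ih =>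
      intro b S hb hn
      obtain ⟨k, hk, hbk⟩ := (Set.ncard_pos (S.finite_right b)).1 (by omega)
      have h1 : P (Finsupp.single (S.remove k) 1) := by
        refine ih b (S.remove k) (fun j hj => ⟨hb j hj, fun e => ?_⟩) ?_
        · rw [Set.mem_singleton_iff] at e; omega
        · have : {j | j ∈ (S.remove k).carrier ∧ b < j} =
              {j | j ∈ S.carrier ∧ b < j} \ {k} := by
            ext j
            simp only [Maya.remove, Set.mem_sdiff, Set.mem_singleton_iff, Set.mem_ofPred_eq]
            tauto
          have hmem : k ∈ {j | j ∈ S.carrier ∧ b < j} := ⟨hk, hbk⟩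
          rw [this, Set.ncard_sdiff_singleton_of_mem hmem, hn]
          rfl
      have h2 := hsmul ((-1) ^ (S.remove k).numRight k) _ (hstar k _ h1)
      rw [psiStar_single, if_neg (fun h => h.2 rfl), Maya.add_remove hk, Finsupp.smul_single,
        smul_eq_mul, mul_one, ← mul_pow] at h2
      simpa using h2
  induction v using Finsupp.induction_linear with
  | zero => simpa using hsmul 0 _ (hvac 0)
  | add f g hf hg => exact hadd _ _ hf hg
  | single S c =>
    obtain ⟨b, hb⟩ := exists_forall_le_mem S
    have := hsmul c _ (key _ b S hb rfl)
    rwa [Finsupp.smul_single, smul_eq_mul, mul_one] at this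

/-- All sufficiently deep positions are occupied in each of the finitely many configurations making
up `v`. -/
theorem exists_psiStar_eq_zero (a : ℤ) (v : Fock K) :
    ∃ D : ℕ, ∀ d, D ≤ d → psiStar K (a - d) v = 0 := by
  induction v using Finsupp.induction_linear with
  | zero => exact ⟨0, fun d _ => map_zero _⟩
  | add f g hf hg =>
    obtain ⟨D, hD⟩ := hf
    obtain ⟨D', hD'⟩ := hg
    exact ⟨D + D', fun d hd => by rw [map_add, hD d (by omega), hD' d (by omega), add_zero]⟩
  | single S c =>
    obtain ⟨b, hb⟩ := exists_forall_le_mem S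
    exact ⟨(a - b).toNat, fun d hd => by
      rw [psiStar_single, if_pos (hb _ (by omega))]⟩

/-- The formal sum `∑_r f_r ψ*_{a-r}`. -/
noncomputable def creationSeries (f : PowerSeries K) (a : ℤ) : OpSeries K :=
  PowerSeries.mk fun r => PowerSeries.coeff r f • psiStar K (a - (r : ℤ))

theorem finiteAt_creationSeries (f : PowerSeries K) (a : ℤ) (v : Fock K) :
    FiniteAt (creationSeries f a) v := by
  obtain ⟨D, hD⟩ := exists_psiStar_eq_zero a v
  refine ⟨D, fun d hd => ?_⟩
  rw [creationSeries, PowerSeries.coeff_mk, LinearMap.smul_apply, hD d hd, smul_zero]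

/-- The conjugation lemma for the sequence `s_r = ψ*_{a-r}`, which `J_q` shifts by `q`. -/
theorem expOp_mul_psiStar [CharZero K] (x t : K) (a : ℤ) :
    expOp (phiPlus x t) * op (psiStar K a) =
      creationSeries (ratio x t) a * expOp (phiPlus x t) := by
  have h := expSeries_mul_C (φ := phiPlus x t) (p := logRatio x t)
    (s := fun r : ℕ => psiStar K (a - (r : ℤ))) (by simp [phiPlus]) (by simp [logRatio]) ?_
  · rw [expSeries_logRatio] at h
    simp only [Nat.cast_zero, sub_zero] at h
    exact h
  · intro q r
    simp only [phiPlus, logRatio, PowerSeries.coeff_mk]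
    split_ifs with hq
    · simp
    · rw [smul_mul_assoc, J_mul_psiStar (by omega), smul_add, mul_smul_comm]
      congr 3
      push_cast; ring

theorem coeff_expOp_vacVec (x t : K) (b : ℤ) {d : ℕ} (hd : d ≠ 0) :
    PowerSeries.coeff d (expOp (phiPlus x t)) (vacVec K b) = 0 := by
  have h1 : ∀ q, PowerSeries.coeff q (phiPlus x t) (vacVec K b) = 0 := by
    intro q
    simp only [phiPlus, PowerSeries.coeff_mk]
    split_ifs with hq
    · rfl
    · rw [LinearMap.smul_apply, J_vacVec (by omega), smul_zero]
  simp only [expOp, PowerSeries.coeff_mk, LinearMap.sum_apply, LinearMap.smul_apply]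
  refine sum_eq_zero fun m _ => ?_
  cases m with
  | zero => simp [PowerSeries.coeff_one, hd]
  | succ m =>
    rw [pow_succ, PowerSeries.coeff_mul, LinearMap.sum_apply, sum_eq_zero, smul_zero]
    intro a _
    rw [Module.End.mul_apply, h1, map_zero]

/-- On the vacua only degree 0 acts. Finiteness passes from `v` to `ψ*_a v` by commuting `ψ*_a` out
to the left as a locally finite series, and such vectors span. -/
theorem finiteAt_expOp [CharZero K] (x t : K) (v : Fock K) : FiniteAt (expOp (phiPlus x t)) v := by
  induction v using fock_induction with
  | hvac b => exact ⟨1, fun d hd => coeff_expOp_vacVec x t b (by omega)⟩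
  | hadd v w hv hw =>
    obtain ⟨D, hD⟩ := hv
    obtain ⟨D', hD'⟩ := hw
    exact ⟨D + D', fun d hd => by rw [map_add, hD d (by omega), hD' d (by omega), add_zero]⟩
  | hsmul c v hv =>
    obtain ⟨D, hD⟩ := hv
    exact ⟨D, fun d hd => by rw [map_smul, hD d hd, smul_zero]⟩
  | hstar a v hv =>
    obtain ⟨D, hD⟩ := FiniteAt.mul (finiteAt_creationSeries (ratio x t) a) hv
    refine ⟨D, fun d hd => ?_⟩
    have h := hD d hd
    rw [← expOp_mul_psiStar, op, PowerSeries.coeff_mul_C] at h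
    exact h

theorem exists_halfVertex [CharZero K] (x t : K) : ∃ B, SumsTo (expOp (phiPlus x t)) B :=
  exists_sumsTo (finiteAt_expOp x t)

/-- The operator `e^{φ₊(x;t)}` on Fock space. -/
noncomputable def halfVertex [CharZero K] (x t : K) : Module.End K (Fock K) :=
  (exists_halfVertex x t).choose

theorem sumsTo_halfVertex [CharZero K] (x t : K) :
    SumsTo (expOp (phiPlus x t)) (halfVertex x t) :=
  (exists_halfVertex x t).choose_spec

/-- The operator `∑_r f_r ψ*_{a-r}` for `f = 1 + (1 + t) ∑_{r ≥ 1} x^r`. -/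
noncomputable def dressed (x t : K) (a : ℤ) : Module.End K (Fock K) :=
  (exists_sumsTo (finiteAt_creationSeries (ratio x t) a)).choose

theorem sumsTo_dressed (x t : K) (a : ℤ) :
    SumsTo (creationSeries (ratio x t) a) (dressed x t a) :=
  (exists_sumsTo (finiteAt_creationSeries (ratio x t) a)).choose_spec

theorem halfVertex_mul_psiStar [CharZero K] (x t : K) (a : ℤ) :
    halfVertex x t * psiStar K a = dressed x t a * halfVertex x t := by
  have h := (sumsTo_halfVertex x t).mul (sumsTo_op (psiStar K a))
  rw [expOp_mul_psiStar] at h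
  exact h.unique ((sumsTo_dressed x t a).mul (sumsTo_halfVertex x t))

theorem halfVertex_vacVec [CharZero K] (x t : K) (b : ℤ) :
    halfVertex x t (vacVec K b) = vacVec K b := by
  obtain ⟨D, hD⟩ := sumsTo_halfVertex x t (vacVec K b)
  rw [← hD (D + 1) (by omega), sum_range_succ', sum_eq_zero fun d _ =>
    coeff_expOp_vacVec x t b (Nat.succ_ne_zero d), zero_add]
  simp [expOp]

theorem dressed_vacVec (x t : K) {a b : ℤ} (h : a ≤ b) : dressed x t a (vacVec K b) = 0 := by
  obtain ⟨D, hD⟩ := sumsTo_dressed x t a (vacVec K b)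
  rw [← hD D le_rfl]
  refine sum_eq_zero fun d _ => ?_
  rw [creationSeries, PowerSeries.coeff_mk, LinearMap.smul_apply, psiStar_vacVec (by omega),
    smul_zero]

/-- The particle in flight: `x ∑_{r ≥ 0} (1 + t) x^r ψ*_{a-r}`. -/
noncomputable def flight (x t : K) (a : ℤ) : Module.End K (Fock K) :=
  x • dressed x t a + (x * t) • psiStar K a

/-- The tail `r ≥ 1` of the dressed operator is a flight starting at `a`. In ice terms, below an up
edge with no particle arriving, the particle either stays in its column or takes off, with weight 1
each. -/
theorem dressed_eq (x t : K) (a : ℤ) :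
    dressed x t (a + 1) = psiStar K (a + 1) + flight x t a := by
  refine LinearMap.ext fun v => ?_
  obtain ⟨D, hD⟩ := sumsTo_dressed x t (a + 1) v
  obtain ⟨D', hD'⟩ := sumsTo_dressed x t a v
  rw [flight, LinearMap.add_apply, LinearMap.add_apply, LinearMap.smul_apply, LinearMap.smul_apply,
    ← hD (D + D' + 1 + 1) (by omega), ← hD' (D + D' + 1) (by omega), sum_range_succ',
    sum_range_succ', sum_range_succ' _ (D + D')]
  simp only [creationSeries, ratio, PowerSeries.coeff_mk, LinearMap.smul_apply]
  have h1 : ∀ k : ℕ, a + 1 - ((k + 1 + 1 : ℕ) : ℤ) = a - ((k + 1 : ℕ) : ℤ) := by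
    intro k; push_cast; ring
  simp only [h1, Nat.succ_ne_zero, if_false, if_true, zero_add, smul_add, smul_sum, smul_smul]
  simp only [Nat.cast_zero, sub_zero, Nat.cast_one, add_sub_cancel_right, pow_one, mul_one]
  have h2 : ∀ k : ℕ, x * ((1 + t) * x ^ (k + 1)) = (1 + t) * x ^ (k + 1 + 1) := by
    intro k; ring
  simp only [h2, one_smul]
  rw [show (1 + t) * x = x + x * t by ring, add_smul]
  abel

theorem dressed_psiStar (x t : K) (a b : ℤ) :
    dressed x t a * psiStar K b = -(psiStar K b * dressed x t a) := by
  refine LinearMap.ext fun v => ?_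
  obtain ⟨D, hD⟩ := sumsTo_dressed x t a v
  obtain ⟨D', hD'⟩ := sumsTo_dressed x t a (psiStar K b v)
  rw [LinearMap.neg_apply, Module.End.mul_apply, Module.End.mul_apply, ← hD (D + D') (by omega),
    ← hD' (D + D') (by omega), map_sum, ← sum_neg_distrib]
  refine sum_congr rfl fun d _ => ?_
  simp only [creationSeries, PowerSeries.coeff_mk, LinearMap.smul_apply, map_smul]
  have h := LinearMap.congr_fun (psiStar_anticomm K (a - d) b) v
  rw [← smul_neg]
  congr 1
  exact eq_neg_of_add_eq_zero_left h

/-- A series of mutually anticommuting operators has a square equal to its own negative, and 2 is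
invertible. -/
theorem dressed_mul_self [CharZero K] (x t : K) (a : ℤ) : dressed x t a * dressed x t a = 0 := by
  refine LinearMap.ext fun v => ?_
  obtain ⟨D, hD⟩ := sumsTo_dressed x t a v
  obtain ⟨D', hD'⟩ := sumsTo_dressed x t a (dressed x t a v)
  have h : dressed x t a (dressed x t a v) = -dressed x t a (dressed x t a v) := by
    nth_rewrite 2 [← hD (D + D') (by omega)]
    rw [← hD' (D + D') (by omega), map_sum, ← sum_neg_distrib]
    refine sum_congr rfl fun d _ => ?_
    simp only [creationSeries, PowerSeries.coeff_mk, LinearMap.smul_apply, map_smul]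
    rw [← smul_neg]
    congr 1
    have h := LinearMap.congr_fun (dressed_psiStar x t a (a - d)) v
    rw [LinearMap.neg_apply, Module.End.mul_apply, Module.End.mul_apply] at h
    rw [h, neg_neg]
  have h2 : (2 : K) • dressed x t a (dressed x t a v) = 0 := by
    rw [two_smul]; nth_rewrite 1 [h]; exact neg_add_cancel _
  exact (smul_eq_zero.1 h2).resolve_left two_ne_zero

/-- A particle flying over an empty column lands with weight `x(t + 1)` or flies on with weight `x`.
-/
theorem flight_eq (x t : K) (a : ℤ) :
    flight x t (a + 1) = (x * (t + 1)) • psiStar K (a + 1) + x • flight x t a := by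
  rw [flight, dressed_eq, smul_add, mul_add, mul_one, add_smul]
  abel

/-- Exclusion: `D² = 0` leaves only `xt ψ* D`, and `(ψ*)² = 0` replaces `D` there by `Φ`. So a
particle flying over an occupied column has a single outcome, of weight `tx`. -/
theorem flight_mul_dressed [CharZero K] (x t : K) (a : ℤ) :
    flight x t (a + 1) * dressed x t (a + 1) =
      (t * x) • (psiStar K (a + 1) * flight x t a) := by
  have hsq : psiStar K (a + 1) * psiStar K (a + 1) = 0 := by
    refine LinearMap.ext fun v => ?_
    have h := LinearMap.congr_fun (psiStar_anticomm K (a + 1) (a + 1)) v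
    rw [LinearMap.add_apply, LinearMap.zero_apply, ← two_smul K] at h
    exact (smul_eq_zero.1 h).resolve_left two_ne_zero
  have hneg : psiStar K (a + 1) * dressed x t (a + 1) = psiStar K (a + 1) * flight x t a := by
    rw [dressed_eq, mul_add, hsq, zero_add]
  rw [flight, add_mul, smul_mul_assoc, smul_mul_assoc, dressed_mul_self, smul_zero, zero_add, hneg,
    mul_comm x t]

theorem flight_vacVec_of_le (x t : K) {a b : ℤ} (h : a ≤ b) : flight x t a (vacVec K b) = 0 := by
  rw [flight, LinearMap.add_apply, LinearMap.smul_apply, LinearMap.smul_apply, dressed_vacVec x t h,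
    psiStar_vacVec h, smul_zero, smul_zero, add_zero]

/-- Position `b` is the only free landing site. This is the origin of the factor `(t_i + 1)x_i` of a
Δ-row. -/
theorem flight_vacVec_succ (x t : K) (b : ℤ) :
    flight x t b (vacVec K (b - 1)) = (x * (t + 1)) • vacVec K b := by
  have h := flight_eq x t (b - 1)
  rw [sub_add_cancel] at h
  rw [h, LinearMap.add_apply, LinearMap.smul_apply, LinearMap.smul_apply, psiStar_vacVec_succ,
    flight_vacVec_of_le x t le_rfl, smul_zero, add_zero]

end HalfVertex

/-! ## Rows of the six-vertex model as matrix elements -/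

section RowSums

open Finset

variable {K : Type*} [Field K]

theorem sum_fin_snoc {U M : Type*} [Fintype U] [AddCommMonoid M] {m : ℕ}
    (F : (Fin (m + 1) → U) → M) :
    ∑ u, F u = ∑ b : U, ∑ u : Fin m → U, F (Fin.snoc (α := fun _ => U) u b) := by
  classical
  rw [← Fintype.sum_prod_type']
  exact (Fintype.sum_equiv (Fin.snocEquiv fun _ => U) _ _ fun _ => rfl).symm

/-- The sum of the weights of the states of a row with vertical edges `top` and `bot`, left edge `e`
and right edge `f`. -/
def rowSum (w : Bool → Bool → Bool → Bool → K) :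
    (N : ℕ) → (Fin N → Bool) → (Fin N → Bool) → Bool → Bool → K
  | 0, _, _, e, f => if e = f then 1 else 0
  | N + 1, top, bot, e, f => ∑ g : Bool, w e g (top (Fin.last N)) (bot (Fin.last N)) *
      rowSum w N (fun c => top c.castSucc) (fun c => bot c.castSucc) g f

/-- The number of occupied columns. -/
def numOcc {N : ℕ} (u : Fin N → Bool) : ℕ := ∑ c, if u c then 1 else 0

/-- Each vertex of nonzero weight conserves particles, where a left-pointing edge carries one. -/
theorem numOcc_eq_of_rowSum_delta_ne_zero (x t : K) {N : ℕ} {top bot : Fin N → Bool} {e f : Bool}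
    (h : rowSum (deltaVertex x t) N top bot e f ≠ 0) :
    numOcc top + (if e then 0 else 1) = numOcc bot + (if f then 0 else 1) := by
  induction N generalizing e with
  | zero =>
    simp only [rowSum, ne_eq, ite_eq_right_iff, one_ne_zero, imp_false, not_not] at h
    simp [numOcc, h]
  | succ N ih =>
    obtain ⟨g, -, hg⟩ := exists_ne_zero_of_sum_ne_zero h
    have h1 := ih (right_ne_zero_of_mul hg)
    have h2 := left_ne_zero_of_mul hg
    simp only [numOcc] at h1 ⊢
    rw [Fin.sum_univ_castSucc, Fin.sum_univ_castSucc]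
    revert h1 h2
    cases top (Fin.last N) <;> cases bot (Fin.last N) <;> cases e <;> cases g <;>
      simp [deltaVertex] <;> omega

/-- Turning a row of `Δ`-ice upside down gives a row of `Γ`-ice, with inverse parameter. -/
theorem rowSum_delta_inv {x : K} (hx : x ≠ 0) (t : K) {N : ℕ} (a b : Fin N → Bool) (e f : Bool) :
    rowSum (deltaVertex x⁻¹ t) N a b e f * (if f then 1 else t + 1) =
      (x⁻¹) ^ N * (if e then 1 else t + 1) * rowSum (gammaVertex x t) N b a (!e) (!f) := by
  induction N generalizing e with
  | zero => cases e <;> cases f <;> simp [rowSum]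
  | succ N ih =>
    -- The identity holds vertex by vertex with a gauge factor on horizontal edges, 1 for
    -- right-pointing and `t + 1` for left-pointing, which telescopes along the row. Since `t + 1`
    -- may vanish, it is carried across and never divided out.
    have hv : ∀ g p q, deltaVertex x⁻¹ t e g p q * (if g then 1 else t + 1) =
        x⁻¹ * (if e then 1 else t + 1) * gammaVertex x t (!e) (!g) q p := by
      intro g p q
      cases e <;> cases g <;> cases p <;> cases q <;>
        (simp [deltaVertex, gammaVertex, hx]; try field_simp)
    have ih' := fun g => ih (fun c => a c.castSucc) (fun c => b c.castSucc) g
    simp only [rowSum, Fintype.sum_bool]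
    have i1 := ih' true
    have i2 := ih' false
    have v1 := hv true (a (Fin.last N)) (b (Fin.last N))
    have v2 := hv false (a (Fin.last N)) (b (Fin.last N))
    simp only [if_true, mul_one, Bool.not_true, Bool.not_false, Bool.false_eq_true, if_false]
      at i1 i2 v1 v2
    rw [add_mul, mul_assoc, mul_assoc, i1, i2, v1]
    have v2' := congrArg (fun z => z * ((x⁻¹) ^ N *
      rowSum (gammaVertex x t) N (fun c => b c.castSucc) (fun c => a c.castSucc) true (!f))) v2
    rw [pow_succ]
    linear_combination v2'

/-- The product of the operators `s_{c+1}` over the occupied columns, in decreasing order. -/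
def wordOp {R : Type*} [Ring R] (s : ℤ → R) : (N : ℕ) → (Fin N → Bool) → R
  | 0, _ => 1
  | N + 1, u => (if u (Fin.last N) then s ((N : ℤ) + 1) else 1) *
      wordOp s N fun c => u c.castSucc

/-- The expansion of a product of dressed operators, in terms of rows of `Δ`-ice. -/
theorem wordOp_expansion {R : Type*} [Ring R] [Algebra K R] {s D Φ : ℤ → R} {x t : K}
    (hD : ∀ a, D (a + 1) = s (a + 1) + Φ a)
    (hΦ : ∀ a, Φ (a + 1) = (x * (t + 1)) • s (a + 1) + x • Φ a)
    (hΦD : ∀ a, Φ (a + 1) * D (a + 1) = (t * x) • (s (a + 1) * Φ a))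
    (N : ℕ) (top : Fin N → Bool) (e : Bool) :
    (if e then 1 else Φ N) * wordOp D N top = ∑ bot : Fin N → Bool, wordOp s N bot *
      (rowSum (deltaVertex x t) N top bot e true • (1 : R) +
        rowSum (deltaVertex x t) N top bot e false • Φ 0) := by
  induction N generalizing e with
  | zero => cases e <;> simp [wordOp, rowSum]
  | succ N ih =>
    -- One column: the prefix is `Φ` exactly when the left edge points left. The four choices of
    -- left and top edge use the three relations and one trivial case, and yield the six weights.
    have step : (if e then 1 else Φ ((N + 1 : ℕ) : ℤ)) * wordOp D (N + 1) top =
        ∑ b : Bool, (if b then s ((N : ℤ) + 1) else 1) *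
          ∑ g : Bool, deltaVertex x t e g (top (Fin.last N)) b •
            ((if g then 1 else Φ N) * wordOp D N fun c => top c.castSucc) := by
      simp only [wordOp, Nat.cast_add, Nat.cast_one, Fintype.sum_bool]
      cases e <;> cases top (Fin.last N) <;> simp only [deltaVertex, if_true, if_false,
        Bool.false_eq_true, one_mul, one_smul, zero_smul, add_zero, zero_add, mul_zero]
      · rw [hΦ, add_mul, smul_mul_assoc, smul_mul_assoc, mul_smul_comm]
      · rw [← mul_assoc, hΦD, smul_mul_assoc, mul_smul_comm, mul_assoc]
      · rw [hD, add_mul]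
    rw [step, sum_fin_snoc]
    refine sum_congr rfl fun b _ => ?_
    rw [mul_sum]
    simp only [ih, smul_sum, mul_sum]
    rw [sum_comm]
    refine sum_congr rfl fun u _ => ?_
    simp only [wordOp, rowSum, Fin.snoc_last, Fin.snoc_castSucc, Fintype.sum_bool]
    simp only [← mul_assoc, mul_smul, mul_add, add_smul, smul_add, mul_smul_comm]
    abel

end RowSums

/-! ### Vertex operators acting on column configurations. -/

section RowOperators

open Finset

variable {K : Type*} [Field K]

/-- The configuration in which all positions `k ≤ 0` and the columns marked by `u` are occupied. -/
def colMaya {N : ℕ} (u : Fin N → Bool) : Maya where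
  carrier := {k | k ≤ 0 ∨ ∃ c, u c = true ∧ k = (c : ℕ) + 1}
  finite_particles := by
    refine (Set.finite_Ioc 0 (N : ℤ)).subset ?_
    rintro k ⟨h | ⟨c, _, rfl⟩, hk⟩
    · omega
    · exact ⟨hk, by have := c.isLt; omega⟩
  finite_holes := by
    convert Set.finite_empty (α := ℤ) using 1
    ext k
    simp only [Set.mem_ofPred_eq, Set.mem_empty_iff_false, iff_false, not_and]
    intro h h'
    exact h (Or.inl h')

theorem colMaya_injective {N : ℕ} : Function.Injective (colMaya (N := N)) := by
  have key : ∀ u v : Fin N → Bool, colMaya u = colMaya v → ∀ c, u c = true → v c = true := by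
    intro u v h c hc
    have h1 : ((c : ℕ) + 1 : ℤ) ∈ (colMaya u).carrier := Or.inr ⟨c, hc, rfl⟩
    rw [h] at h1
    rcases h1 with h1 | ⟨c', hc', e⟩
    · omega
    · have : c = c' := Fin.ext (by omega)
      rwa [this]
  intro u v h
  funext c
  exact Bool.eq_iff_iff.2 ⟨key u v h c, key v u h.symm c⟩

/-- The vector `∏ ψ*_{c+1} |0⟩` over the occupied columns. -/
noncomputable def colVec (K : Type*) [Field K] {N : ℕ} (u : Fin N → Bool) : Fock K :=
  Finsupp.single (colMaya u) 1

theorem numRight_eq_zero {S : Maya} {k : ℤ} (h : ∀ j ∈ S.carrier, j ≤ k) : S.numRight k = 0 := by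
  unfold Maya.numRight
  rw [Set.ncard_eq_zero (S.finite_right k)]
  ext j
  simp only [Set.mem_ofPred_eq, Set.mem_empty_iff_false, iff_false, not_and, not_lt]
  exact h j

/-- The columns are filled in increasing order, each to the right of all particles present, so no
sign appears. -/
theorem wordOp_psiStar_vacVec {N : ℕ} (u : Fin N → Bool) :
    wordOp (psiStar K) N u (vacVec K 0) = colVec K u := by
  induction N with
  | zero =>
    rw [wordOp, Module.End.one_apply, colVec, vacVec]
    congr 1
    ext k
    simp [colMaya, vacAt]
  | succ N ih =>
    rw [wordOp, Module.End.mul_apply, ih, colVec, colVec]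
    have hlt : ∀ j ∈ (colMaya fun c : Fin N => u c.castSucc).carrier, j ≤ (N : ℤ) := by
      rintro j (h | ⟨c, _, rfl⟩)
      · omega
      · have := c.isLt; omega
    split_ifs with h
    · rw [psiStar_single, if_neg (fun h' => by have := hlt _ h'; omega),
        numRight_eq_zero fun j hj => by have := hlt _ hj; omega, pow_zero, mul_one]
      congr 1
      ext k
      simp only [Maya.add, colMaya, Set.mem_insert_iff, Set.mem_ofPred_eq, Fin.exists_fin_succ',
        Fin.val_castSucc, Fin.val_last, h, true_and]
      exact or_left_comm.trans (or_congr_right or_comm)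
    · rw [Module.End.one_apply]
      congr 1
      ext k
      simp [colMaya, Fin.exists_fin_succ', h]

/-- One sign for each creation operator passed, with no contraction since `k ≤ 0`. This is the
origin of `(-1)^i` in a Δ-row. -/
theorem psi_mul_wordOp {N : ℕ} (u : Fin N → Bool) {k : ℤ} (hk : k ≤ 0) :
    psi K k * wordOp (psiStar K) N u =
      ((-1 : K) ^ numOcc u) • (wordOp (psiStar K) N u * psi K k) := by
  induction N with
  | zero => simp [wordOp, numOcc]
  | succ N ih =>
    have hs : numOcc u = numOcc (fun c : Fin N => u c.castSucc) +
        if u (Fin.last N) then 1 else 0 := Fin.sum_univ_castSucc _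
    rw [wordOp, hs]
    split_ifs with h
    · have e : psi K k * psiStar K ((N : ℤ) + 1) = -(psiStar K ((N : ℤ) + 1) * psi K k) := by
        refine LinearMap.ext fun v => ?_
        have h1 := LinearMap.congr_fun (psi_psiStar_anticomm K k ((N : ℤ) + 1)) v
        rw [if_neg (by omega)] at h1
        exact eq_neg_of_add_eq_zero_left h1
      refine LinearMap.ext fun v => ?_
      have e' := LinearMap.congr_fun e (wordOp (psiStar K) N (fun c => u c.castSucc) v)
      have ih' := LinearMap.congr_fun (ih fun c => u c.castSucc) v
      simp only [Module.End.mul_apply, LinearMap.neg_apply, LinearMap.smul_apply] at e' ih' ⊢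
      rw [e', ih', map_smul, pow_succ, mul_neg_one, neg_smul]
    · rw [one_mul, ih, add_zero]

theorem psi_colVec {N : ℕ} (u : Fin N → Bool) :
    psi K 0 (colVec K u) =
      ((-1 : K) ^ numOcc u) • wordOp (psiStar K) N u (vacVec K (-1)) := by
  rw [← wordOp_psiStar_vacVec, ← Module.End.mul_apply, psi_mul_wordOp u le_rfl,
    LinearMap.smul_apply, Module.End.mul_apply, psi_vacVec_self]
  rfl

theorem psi_wordOp_vacVec {N : ℕ} (u : Fin N → Bool) :
    psi K 0 (wordOp (psiStar K) N u (vacVec K (-1))) = 0 := by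
  rw [← Module.End.mul_apply, psi_mul_wordOp u le_rfl, LinearMap.smul_apply, Module.End.mul_apply,
    psi_vacVec (by omega), map_zero, smul_zero]

/-- Position 0 is occupied in `colMaya u`, so `colVec u` lies in the image of `ψ*_0`, the adjoint of
`ψ_0`. -/
theorem colMaya_eq_zero_of_psi_eq_zero {N : ℕ} {v : Fock K} (hv : psi K 0 v = 0)
    (u : Fin N → Bool) : v (colMaya u) = 0 := by
  have h : v (colMaya u) = pairing (colVec K u) v := by
    rw [colVec, pairing_single, one_mul]
  have h0 : colVec K u = psiStar K 0 (psi K 0 (colVec K u)) := by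
    have e := LinearMap.congr_fun (psi_psiStar_anticomm K 0 0) (colVec K u)
    have hz : psiStar K 0 (colVec K u) = 0 := by
      exact (psiStar_single K 0 (colMaya u) 1).trans (if_pos (Or.inl le_rfl))
    rw [if_pos rfl, LinearMap.add_apply, Module.End.mul_apply, Module.End.mul_apply, hz, map_zero,
      zero_add] at e
    exact e.symm
  rw [h, h0, (isAdj_psi_psiStar 0).symm, hv, pairing_comm, pairing_zero_left]

theorem colMaya_psiStar {N : ℕ} (v : Fock K) (u : Fin N → Bool) :
    psiStar K ((N : ℤ) + 1) v (colMaya u) = 0 := by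
  have h : psiStar K ((N : ℤ) + 1) v (colMaya u) =
      pairing (colVec K u) (psiStar K ((N : ℤ) + 1) v) := by
    rw [colVec, pairing_single, one_mul]
  rw [h, ← isAdj_psi_psiStar, colVec, psi_single, if_neg, pairing_zero_left]
  rintro (h | ⟨c, _, e⟩)
  · omega
  · have := c.isLt; omega

theorem halfVertex_wordOp [CharZero K] (x t : K) {N : ℕ} (u : Fin N → Bool) :
    halfVertex x t * wordOp (psiStar K) N u = wordOp (dressed x t) N u * halfVertex x t := by
  induction N with
  | zero => simp [wordOp]
  | succ N ih =>
    rw [wordOp, wordOp, mul_assoc, ← ih]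
    split_ifs
    · rw [← mul_assoc, halfVertex_mul_psiStar, mul_assoc]
    · rw [one_mul, one_mul]

/-- The action of `e^{φ₊} ψ_{-1/2}`: rows of `Δ`-ice, up to terms killed by `ψ_{-1/2}`. -/
theorem halfVertex_psi_colVec [CharZero K] (x t : K) {N : ℕ} (top : Fin N → Bool) :
    ∃ v : Fock K, psi K 0 v = 0 ∧ halfVertex x t (psi K 0 (colVec K top)) = v +
      ∑ bot : Fin N → Bool, ((-1) ^ numOcc top * (t + 1) * x *
        rowSum (deltaVertex x t) N top bot true false) • colVec K bot := by
  have h := wordOp_expansion (s := psiStar K) (D := dressed x t) (Φ := flight x t) (x := x) (t := t)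
    (dressed_eq x t) (flight_eq x t) (flight_mul_dressed x t) N top true
  rw [if_pos rfl, one_mul] at h
  -- The error term collects the states whose right edge points right: no particle leaves the row
  -- and the hole at code 0 stays open.
  refine ⟨((-1 : K) ^ numOcc top) • ∑ bot : Fin N → Bool,
    rowSum (deltaVertex x t) N top bot true true • wordOp (psiStar K) N bot (vacVec K (-1)), ?_, ?_⟩
  · rw [map_smul, map_sum, sum_eq_zero, smul_zero]
    intro u _
    rw [map_smul, psi_wordOp_vacVec, smul_zero]
  · rw [psi_colVec, map_smul, ← Module.End.mul_apply, halfVertex_wordOp, Module.End.mul_apply,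
      halfVertex_vacVec, h, LinearMap.sum_apply, smul_sum, smul_sum, ← sum_add_distrib]
    refine sum_congr rfl fun u _ => ?_
    -- In the remaining states the flying particle leaves the row and fills the hole, restoring the
    -- vacuum.
    have hf : flight x t 0 (vacVec K (-1)) = (x * (t + 1)) • vacVec K 0 := flight_vacVec_succ x t 0
    rw [Module.End.mul_apply, LinearMap.add_apply, LinearMap.smul_apply, LinearMap.smul_apply,
      Module.End.one_apply, hf, map_add, map_smul, map_smul, map_smul, wordOp_psiStar_vacVec,
      smul_add, smul_smul, smul_smul, smul_smul]
    congr 2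
    ring

/-- The action of `e^{φ₊} ψ*_{N+1/2}`: rows of `Γ`-ice, up to terms with an occupied position
`N + 1/2`. -/
theorem halfVertex_psiStar_colVec [CharZero K] {x : K} (hx : x ≠ 0) (t : K) {N : ℕ}
    (bot : Fin N → Bool) :
    ∃ v : Fock K, halfVertex x⁻¹ t (psiStar K ((N : ℤ) + 1) (colVec K bot)) =
      psiStar K ((N : ℤ) + 1) v +
      ∑ top : Fin N → Bool, ((t + 1) * x ^ (-(N : ℤ)) *
        rowSum (gammaVertex x t) N top bot true false) • colVec K top := by
  have h := wordOp_expansion (s := psiStar K) (D := dressed x⁻¹ t) (Φ := flight x⁻¹ t) (x := x⁻¹)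
    (t := t) (dressed_eq x⁻¹ t) (flight_eq x⁻¹ t) (flight_mul_dressed x⁻¹ t) N bot false
  rw [if_neg Bool.false_ne_true] at h
  -- In `D_{N+1} = ψ*_{N+1} + Φ_N` the first summand gives the error term; the second starts the row
  -- with a particle in flight.
  refine ⟨wordOp (dressed x⁻¹ t) N bot (vacVec K 0), ?_⟩
  have hw := LinearMap.congr_fun (halfVertex_wordOp x⁻¹ t bot) (vacVec K 0)
  rw [Module.End.mul_apply, Module.End.mul_apply, halfVertex_vacVec] at hw
  rw [← wordOp_psiStar_vacVec, ← Module.End.mul_apply, halfVertex_mul_psiStar, Module.End.mul_apply,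
    hw, dressed_eq, LinearMap.add_apply]
  congr 1
  rw [← Module.End.mul_apply, h, LinearMap.sum_apply]
  refine sum_congr rfl fun u _ => ?_
  have hr := rowSum_delta_inv hx t bot u false true
  simp only [if_true, mul_one, Bool.false_eq_true, if_false, Bool.not_true, Bool.not_false] at hr
  -- Here `Φ_0` kills the full vacuum, so only rows whose right edge points right remain; the
  -- inversion identity reverses both boundary edges.
  rw [Module.End.mul_apply, LinearMap.add_apply, LinearMap.smul_apply, LinearMap.smul_apply,
    Module.End.one_apply, flight_vacVec_of_le _ _ le_rfl, smul_zero, add_zero, map_smul,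
    wordOp_psiStar_vacVec, hr, zpow_neg, zpow_natCast, inv_pow, mul_comm (t + 1)]

end RowOperators

/-! ## Sums over paths and partition functions -/

section PathSums

open Finset

variable {K : Type*} [Field K]

/-- The sum over paths from `u₀` to `u` of the products of the transition weights. -/
def pathSum {U : Type*} [Fintype U] [DecidableEq U] (u₀ : U) :
    (m : ℕ) → (Fin m → U → U → K) → U → K
  | 0, _, u => if u = u₀ then 1 else 0
  | m + 1, W, u => ∑ v, W (Fin.last m) u v * pathSum u₀ m (fun i => W i.castSucc) v

/-- Serves twice: for the horizontal edges along one row, and for the vertical configurations from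
level to level. -/
theorem pathSum_eq {U : Type*} [Fintype U] [DecidableEq U] (u₀ : U) {m : ℕ}
    (W : Fin m → U → U → K) (u : U) :
    pathSum u₀ m W u = ∑ h : Fin (m + 1) → U,
      if h (Fin.last m) = u ∧ h 0 = u₀ then ∏ i, W i (h i.succ) (h i.castSucc) else 0 := by
  induction m generalizing u with
  | zero =>
    rw [sum_fin_snoc]
    simp only [pathSum, univ_unique, sum_singleton, univ_eq_empty, prod_empty]
    have h : ∀ b, (Fin.snoc (α := fun _ => U) (default : Fin 0 → U) b) 0 = b := fun b => rfl
    simp only [Fin.last, h, Fin.zero_eta]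
    rw [sum_eq_single u]
    · simp
    · intro b _ hb; simp [hb]
    · simp
  | succ m ih =>
    rw [sum_fin_snoc, sum_eq_single u]
    · rw [pathSum]
      simp only [ih, mul_sum]
      rw [sum_comm]
      refine sum_congr rfl fun h _ => ?_
      rw [sum_eq_single (h (Fin.last m))]
      · have h0 : (Fin.snoc (α := fun _ => U) h u : Fin (m + 2) → U) 0 = h 0 :=
          Fin.snoc_castSucc (α := fun _ => U) u h 0
        rw [h0]
        simp only [Fin.snoc_last, true_and, Fin.prod_univ_castSucc]
        split_ifs
        · rw [Fin.succ_last, Fin.snoc_last, Fin.snoc_castSucc, mul_comm]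
          congr 1
          refine prod_congr rfl fun i _ => ?_
          rw [Fin.succ_castSucc, Fin.snoc_castSucc, Fin.snoc_castSucc]
        · exact mul_zero _
      · intro b _ hb
        rw [if_neg fun h' => hb h'.1.symm, mul_zero]
      · simp
    · intro b _ hb
      refine sum_eq_zero fun h _ => if_neg fun h' => hb ?_
      rw [← h'.1, Fin.snoc_last]
    · simp

theorem rowSum_eq_pathSum (w : Bool → Bool → Bool → Bool → K) {N : ℕ} (top bot : Fin N → Bool)
    (e f : Bool) :
    rowSum w N top bot e f = pathSum f N (fun c l r => w l r (top c) (bot c)) e := by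
  induction N generalizing e with
  | zero => rfl
  | succ N ih => rw [rowSum, pathSum]; exact sum_congr rfl fun g _ => by rw [ih]

/-- Two of the four edges around a vertex point inward; the arguments say whether the left and right
edges point right and whether the top and bottom edges point up. -/
def SixVertex (l r t b : Bool) : Prop :=
  (if l = true then 1 else 0) + (if r = false then 1 else 0) +
    (if t = false then 1 else 0) + (if b = true then 1 else 0) = 2

theorem SixVertex.right_unique {l r r' t b : Bool} (h : SixVertex l r t b)
    (h' : SixVertex l r' t b) : r = r' := by
  revert h h'
  cases l <;> cases r <;> cases r' <;> cases t <;> cases b <;> simp [SixVertex]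

theorem deltaVertex_eq_zero (x t : K) {l r a b : Bool} (h : ¬SixVertex l r a b) :
    deltaVertex x t l r a b = 0 := by
  revert h
  cases l <;> cases r <;> cases a <;> cases b <;> simp [SixVertex, deltaVertex]

theorem gammaVertex_eq_zero (x t : K) {l r a b : Bool} (h : ¬SixVertex l r a b) :
    gammaVertex x t l r a b = 0 := by
  revert h
  cases l <;> cases r <;> cases a <;> cases b <;> simp [SixVertex, gammaVertex]

/-- Three edges of a vertex determine the fourth, so from the left boundary onwards every horizontal
edge is forced and the row sum has just this one term. -/
theorem prod_eq_rowSum {w : Bool → Bool → Bool → Bool → K}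
    (hw : ∀ l r a b, ¬SixVertex l r a b → w l r a b = 0) {N : ℕ} {top bot : Fin N → Bool}
    {h : Fin (N + 1) → Bool} (hs : ∀ c, SixVertex (h c.succ) (h c.castSucc) (top c) (bot c)) :
    ∏ c, w (h c.succ) (h c.castSucc) (top c) (bot c) =
      rowSum w N top bot (h (Fin.last N)) (h 0) := by
  induction N with
  | zero => simp [rowSum]
  | succ N ih =>
    rw [Fin.prod_univ_castSucc, rowSum, sum_eq_single (h (Fin.last N).castSucc), mul_comm,
      Fin.succ_last]
    · congr 1
      exact ih (h := fun i => h i.castSucc) fun c => hs c.castSucc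
    · intro g _ hg
      rw [hw, zero_mul]
      intro hg'
      exact hg (hg'.right_unique (hs (Fin.last N)))
    · simp

/-- The columns that are parts of `a`. -/
def marks {i : ℕ} (N : ℕ) (a : Fin i → ℕ) : Fin N → Bool :=
  fun c => decide (∃ k, a k = (c : ℕ) + 1)

theorem marks_eq_true_iff {i N : ℕ} (a : Fin i → ℕ) (c : Fin N) :
    marks N a c = true ↔ ∃ k, a k = (c : ℕ) + 1 := decide_eq_true_iff

/-- The partition function as a sum over the configurations of the vertical edges. -/
theorem sum_iceStates {n : ℕ} [NeZero n] (lam : Fin n → ℕ)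
    {w : Fin n → Bool → Bool → Bool → Bool → K}
    (hw : ∀ i l r a b, ¬SixVertex l r a b → w i l r a b = 0) :
    ∑ A ∈ iceStates lam, ∏ r, ∏ c, w r (A.leftEdge r c) (A.rightEdge r c) (A.topEdge r c)
      (A.bottomEdge r c) =
    pathSum (fun _ => false) n (fun r top bot => rowSum (w r) (lam 0) top bot true false)
      (marks (lam 0) lam) := by
  classical
  rw [iceStates, sum_filter, pathSum_eq,
    Fintype.sum_equiv (IceConfig.equivProd n (lam 0)) _ (fun p => if
      (IceConfig.mk p.1 p.2).IsAdmissible lam then ∏ r, ∏ c, w r (p.2 r c.succ) (p.2 r c.castSucc)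
        (p.1 r.succ c) (p.1 r.castSucc c) else 0) (fun A => by congr 1),
    Fintype.sum_prod_type]
  refine sum_congr rfl fun up _ => ?_
  split_ifs with hb
  · have h1 : ∀ r, rowSum (w r) (lam 0) (up r.succ) (up r.castSucc) true false =
        ∑ h : Fin (lam 0 + 1) → Bool, if h (Fin.last _) = true ∧ h 0 = false then
          ∏ c, w r (h c.succ) (h c.castSucc) (up r.succ c) (up r.castSucc c) else 0 := by
      intro r
      rw [rowSum_eq_pathSum, pathSum_eq]
    simp only [h1]
    -- The product of row sums becomes a sum over all horizontal edges at once; configurations that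
    -- are not admissible contribute zero on both sides.
    rw [prod_univ_sum, Fintype.piFinset_univ]
    refine sum_congr rfl fun right _ => ?_
    by_cases hlr : ∀ r, right r (Fin.last _) = true ∧ right r 0 = false
    · simp only [hlr, and_self, if_true]
      split_ifs with hA
      · rfl
      · symm
        have : ¬∀ r c, (IceConfig.mk up right).Balanced r c := fun hbal => hA
          ⟨hbal, fun r => (hlr r).1, fun r => (hlr r).2, fun c => congrFun hb.2 c, fun c => by
            have := congrFun hb.1 c
            simp only
            rw [this, marks_eq_true_iff]⟩
        push Not at this
        obtain ⟨r, c, hrc⟩ := this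
        exact prod_eq_zero (mem_univ r) (prod_eq_zero (mem_univ c) (hw r _ _ _ _ hrc))
    · rw [if_neg fun hA => hlr fun r => ⟨hA.left_boundary r, hA.right_boundary r⟩]
      push Not at hlr
      obtain ⟨r, hr⟩ := hlr
      refine (prod_eq_zero (mem_univ r) (if_neg fun h => ?_)).symm
      exact hr h.1 h.2
  · refine sum_eq_zero fun right _ => if_neg fun hA => hb ⟨?_, ?_⟩
    · funext c
      exact Bool.eq_iff_iff.2 ((hA.top_boundary c).trans (marks_eq_true_iff lam c).symm)
    · funext c
      exact hA.bottom_boundary c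

end PathSums

/-! ### Operator products as sums over chains of vertical configurations. -/

section PartitionFunctions

open Finset

variable {K : Type*} [Field K]

theorem colMaya_false (N : ℕ) : colMaya (fun _ : Fin N => false) = Maya.vac := by
  ext k
  simp [colMaya, Maya.vac]

theorem numOcc_eq_of_pathSum_ne_zero {N m : ℕ}
    {w : Fin m → Bool → Bool → Bool → Bool → K}
    (hw : ∀ i (top bot : Fin N → Bool), rowSum (w i) N top bot true false ≠ 0 →
      numOcc top = numOcc bot + 1)
    {u : Fin N → Bool} (h : pathSum (fun _ => false) m
      (fun r top bot => rowSum (w r) N top bot true false) u ≠ 0) : numOcc u = m := by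
  induction m generalizing u with
  | zero =>
    simp only [pathSum, ne_eq, ite_eq_right_iff, one_ne_zero, imp_false, not_not] at h
    simp [h, numOcc]
  | succ m ih =>
    obtain ⟨v, -, hv⟩ := exists_ne_zero_of_sum_ne_zero h
    rw [hw _ _ _ (left_ne_zero_of_mul hv)]
    rw [ih (w := fun i => w i.castSucc) (fun i => hw i.castSucc) (right_ne_zero_of_mul hv)]

/-- The last factor acts first and carries the top row. The first half disposes of its error term:
the next factor opens with `ψ_0`, and if no factor is left, the vacuum has position 0 occupied. -/
theorem list_prod_delta [CharZero K] {N m : ℕ} (x t : Fin m → K) :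
    (∀ v, psi K 0 v = 0 →
      (List.ofFn fun r => halfVertex (x r) (t r) * psi K 0).prod v Maya.vac = 0) ∧
    ∀ u : Fin N → Bool,
      (List.ofFn fun r => halfVertex (x r) (t r) * psi K 0).prod (colVec K u) Maya.vac =
        (∏ r : Fin m, (-1) ^ ((r : ℕ) + 1) * (t r + 1) * x r) *
          pathSum (fun _ => false) m
            (fun r top bot => rowSum (deltaVertex (x r) (t r)) N top bot true false) u := by
  induction m with
  | zero =>
    refine ⟨fun v hv => ?_, fun u => ?_⟩
    · rw [← colMaya_false 0]
      exact colMaya_eq_zero_of_psi_eq_zero hv _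
    · classical
      rw [List.ofFn_zero, List.prod_nil, Module.End.one_apply, colVec, ← colMaya_false N,
        Finsupp.single_apply, pathSum, univ_eq_empty, prod_empty, one_mul]
      simp only [colMaya_injective.eq_iff]
  | succ m ih =>
    obtain ⟨ih1, ih2⟩ := ih (fun r => x r.castSucc) (fun r => t r.castSucc)
    rw [List.ofFn_succ', List.concat_eq_append, List.prod_append, List.prod_singleton]
    refine ⟨fun v hv => ?_, fun u => ?_⟩
    · rw [Module.End.mul_apply, Module.End.mul_apply, hv, map_zero, map_zero, Finsupp.zero_apply]
    · obtain ⟨v, hv, h⟩ := halfVertex_psi_colVec (x (Fin.last m)) (t (Fin.last m)) u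
      rw [Module.End.mul_apply, Module.End.mul_apply, h, map_add, Finsupp.add_apply, ih1 v hv,
        zero_add, map_sum, Finsupp.finsetSum_apply, pathSum, mul_sum]
      refine sum_congr rfl fun bot _ => ?_
      rw [map_smul, Finsupp.smul_apply, ih2, smul_eq_mul, Fin.prod_univ_castSucc, Fin.val_last]
      simp only [Fin.val_castSucc]
      -- The sign produced is `(-1)^{numOcc u}`; it agrees with `(-1)^{m+1}` only when the summand
      -- is nonzero, which forces `m + 1` particles in `u`.
      by_cases h0 : rowSum (deltaVertex (x (Fin.last m)) (t (Fin.last m))) N u bot true false *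
          pathSum (fun _ => false) m (fun r top bot =>
            rowSum (deltaVertex (x r.castSucc) (t r.castSucc)) N top bot true false) bot = 0
      · linear_combination ((-1) ^ numOcc u - (-1) ^ (m + 1)) * (t (Fin.last m) + 1) *
          x (Fin.last m) * (∏ r : Fin m, (-1) ^ ((r : ℕ) + 1) * (t r.castSucc + 1) *
            x r.castSucc) * h0
      · have hn : numOcc u = m + 1 := by
          have e1 := numOcc_eq_of_rowSum_delta_ne_zero _ _ (left_ne_zero_of_mul h0)
          have e2 := numOcc_eq_of_pathSum_ne_zero
            (w := fun r : Fin m => deltaVertex (x r.castSucc) (t r.castSucc))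
            (fun i top bot h => by simpa using numOcc_eq_of_rowSum_delta_ne_zero _ _ h)
            (right_ne_zero_of_mul h0)
          simpa [e2] using e1
        rw [hn]
        ring

/-- In the transposed product the rows are built upwards from the vacuum. An error term lies in the
image of `ψ*_{N+1}`, so the `ψ*_{N+1}` of the next factor kills it. -/
theorem list_prod_gamma [CharZero K] {N m : ℕ} {x t : Fin m → K} (hx : ∀ r, x r ≠ 0) :
    ∃ v, (List.ofFn fun r => halfVertex (x r)⁻¹ (t r) * psiStar K ((N : ℤ) + 1)).reverse.prod
        (vacuum K) = psiStar K ((N : ℤ) + 1) v +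
      ∑ u : Fin N → Bool, ((∏ r, (t r + 1) * x r ^ (-(N : ℤ))) *
        pathSum (fun _ => false) m
          (fun r top bot => rowSum (gammaVertex (x r) (t r)) N top bot true false) u) •
        colVec K u := by
  induction m with
  | zero =>
    refine ⟨0, ?_⟩
    rw [map_zero, zero_add, sum_eq_single (fun _ => false)]
    · simp [pathSum, colVec, colMaya_false, vacuum]
    · intro b _ hb
      simp [pathSum, hb]
    · simp
  | succ m ih =>
    obtain ⟨v, hv⟩ := ih (x := fun r => x r.castSucc) (t := fun r => t r.castSucc)
      fun r => hx _
    choose F hF using fun bot : Fin N → Bool =>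
      halfVertex_psiStar_colVec (hx (Fin.last m)) (t (Fin.last m)) bot
    rw [List.ofFn_succ', List.concat_eq_append, List.reverse_append, List.prod_append,
      List.reverse_singleton, List.prod_singleton, Module.End.mul_apply, hv]
    have hz : psiStar K ((N : ℤ) + 1) (psiStar K ((N : ℤ) + 1) v) = 0 := by
      have h := LinearMap.congr_fun (psiStar_anticomm K ((N : ℤ) + 1) ((N : ℤ) + 1)) v
      rw [LinearMap.add_apply, LinearMap.zero_apply, ← two_smul K] at h
      exact (smul_eq_zero.1 h).resolve_left two_ne_zero
    rw [Module.End.mul_apply, map_add, hz, zero_add, map_sum, map_sum]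
    simp only [map_smul, hF]
    refine ⟨∑ u : Fin N → Bool, ((∏ r : Fin m, (t r.castSucc + 1) * x r.castSucc ^ (-(N : ℤ))) *
        pathSum (fun _ => false) m (fun r top bot =>
          rowSum (gammaVertex (x r.castSucc) (t r.castSucc)) N top bot true false) u) • F u, ?_⟩
    rw [map_sum]
    simp only [map_smul, smul_add, sum_add_distrib]
    congr 1
    simp only [smul_sum, smul_smul]
    rw [sum_comm]
    refine sum_congr rfl fun top _ => ?_
    rw [← sum_smul, pathSum, mul_sum]
    congr 1
    refine sum_congr rfl fun bot _ => ?_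
    rw [Fin.prod_univ_castSucc]
    ring

end PartitionFunctions

/-! ## Ice states and strict Gelfand–Tsetlin patterns -/

section Counting

open Finset

/-- The number of occupied columns weakly to the left of place `e`. -/
def colCount {N : ℕ} (u : Fin N → Bool) (e : ℕ) : ℕ :=
  (univ.filter fun c : Fin N => u c = true ∧ e ≤ c).card

/-- The number of entries of `a` exceeding `e`. -/
def seqCount {i : ℕ} (a : Fin i → ℕ) (e : ℕ) : ℕ := (univ.filter fun j => e < a j).card

theorem colCount_of_le {N : ℕ} (u : Fin N → Bool) {e : ℕ} (h : N ≤ e) : colCount u e = 0 := by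
  rw [colCount, card_eq_zero, filter_eq_empty_iff]
  rintro c - ⟨-, hc⟩
  have := c.isLt
  omega

theorem colCount_succ {N : ℕ} (u : Fin N → Bool) (c : Fin N) :
    colCount u c = colCount u (c + 1) + if u c = true then 1 else 0 := by
  have h : (univ.filter fun d : Fin N => u d = true ∧ (c : ℕ) ≤ d) =
      (univ.filter fun d : Fin N => u d = true ∧ (c : ℕ) + 1 ≤ d) ∪
        if u c = true then {c} else ∅ := by
    ext d
    simp only [mem_filter, mem_univ, true_and, mem_union]
    split_ifs with hc
    · simp only [mem_singleton, Fin.ext_iff]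
      constructor
      · rintro ⟨h1, h2⟩
        by_cases e : (d : ℕ) = c
        · exact Or.inr e
        · exact Or.inl ⟨h1, by omega⟩
      · rintro (⟨h1, h2⟩ | h1)
        · exact ⟨h1, by omega⟩
        · have : d = c := Fin.ext h1
          exact ⟨this ▸ hc, h1.ge⟩
    · simp only [notMem_empty, or_false]
      constructor
      · rintro ⟨h1, h2⟩
        refine ⟨h1, lt_of_le_of_ne h2 fun e => hc ?_⟩
        rwa [Fin.ext e]
      · rintro ⟨h1, h2⟩
        exact ⟨h1, by omega⟩
  rw [colCount, h, card_union_of_disjoint, colCount]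
  · split_ifs <;> rfl
  · split_ifs
    · rw [disjoint_singleton_right, mem_filter]
      rintro ⟨-, -, h⟩
      omega
    · exact disjoint_empty_right _

theorem colCount_zero {N : ℕ} (u : Fin N → Bool) : colCount u 0 = numOcc u := by
  rw [colCount, numOcc, card_filter]
  exact sum_congr rfl fun c _ => by simp

theorem colCount_marks {i N : ℕ} {a : Fin i → ℕ} (ha : StrictAnti a)
    (hpos : ∀ k, 0 < a k) (hle : ∀ k, a k ≤ N) (e : ℕ) :
    colCount (marks N a) e = seqCount a e := by
  symm
  refine card_bij (fun j _ => (⟨a j - 1, by have := hpos j; have := hle j; omega⟩ : Fin N)) ?_ ?_ ?_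
  · intro j hj
    simp only [mem_filter, mem_univ, true_and, marks_eq_true_iff] at hj ⊢
    have := hpos j
    exact ⟨⟨j, by omega⟩, by omega⟩
  · intro j _ k _ h
    have h' := Fin.ext_iff.1 h
    simp only at h'
    have := hpos j
    have := hpos k
    exact ha.injective (by omega)
  · intro c hc
    simp only [mem_filter, mem_univ, true_and, marks_eq_true_iff] at hc
    obtain ⟨⟨k, hk⟩, hc⟩ := hc
    exact ⟨k, by simp; omega, Fin.ext (by simp; omega)⟩

/-- The entries of a decreasing sequence exceeding `e` form an initial segment, so the counting
function recovers each entry. -/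
theorem lt_seqCount_iff {i : ℕ} {a : Fin i → ℕ} (ha : StrictAnti a) (e : ℕ) (j : Fin i) :
    (j : ℕ) < seqCount a e ↔ e < a j := by
  constructor
  · intro h
    by_contra hc
    have : (univ.filter fun k => e < a k) ⊆ Iio j := by
      intro k hk
      rw [mem_Iio]
      by_contra hkj
      have := ha.antitone (not_lt.1 hkj)
      simp only [mem_filter, mem_univ, true_and] at hk
      omega
    have := card_le_card this
    rw [Fin.card_Iio] at this
    exact absurd h (not_lt.2 this)
  · intro h
    have : Iic j ⊆ univ.filter fun k => e < a k := by
      intro k hk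
      have := ha.antitone (mem_Iic.1 hk)
      simp only [mem_filter, mem_univ, true_and]
      omega
    have := card_le_card this
    rw [Fin.card_Iic] at this
    exact this

theorem seqCount_le {i : ℕ} (a : Fin i → ℕ) (e : ℕ) : seqCount a e ≤ i :=
  (card_filter_le _ _).trans (by simp)

theorem seqCount_zero {i : ℕ} {a : Fin i → ℕ} (hpos : ∀ k, 0 < a k) : seqCount a 0 = i := by
  rw [seqCount, filter_true_of_mem fun k _ => hpos k]
  simp

theorem numOcc_marks {i N : ℕ} {a : Fin i → ℕ} (ha : StrictAnti a)
    (hpos : ∀ k, 0 < a k) (hle : ∀ k, a k ≤ N) : numOcc (marks N a) = i := by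
  rw [← colCount_zero, colCount_marks ha hpos hle, seqCount_zero hpos]

theorem eq_of_marks_eq {i N : ℕ} {a b : Fin i → ℕ} (ha : StrictAnti a) (hb : StrictAnti b)
    (hapos : ∀ k, 0 < a k) (hale : ∀ k, a k ≤ N) (hbpos : ∀ k, 0 < b k) (hble : ∀ k, b k ≤ N)
    (h : marks N a = marks N b) : a = b := by
  funext j
  have key : ∀ e, e < a j ↔ e < b j := fun e => by
    rw [← lt_seqCount_iff ha, ← lt_seqCount_iff hb, ← colCount_marks ha hapos hale,
      ← colCount_marks hb hbpos hble, h]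
  have h1 := key (a j)
  have h2 := key (b j)
  omega

/-- Interleaving in terms of the number of entries exceeding a given bound. -/
theorem interleave_iff {i : ℕ} {a : Fin (i + 1) → ℕ} {b : Fin i → ℕ} (ha : StrictAnti a)
    (hb : StrictAnti b) :
    (∀ j, b j ≤ a j.castSucc ∧ a j.succ ≤ b j) ↔
      ∀ e, seqCount b e ≤ seqCount a e ∧ seqCount a e ≤ seqCount b e + 1 := by
  constructor
  · intro h e
    constructor
    · by_contra hc
      have hi := seqCount_le b e
      -- With indices from 0, `seqCount a e` is the first index at which `a` no longer exceeds `e`,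
      -- whereas `b` still does.
      have h1 := (lt_seqCount_iff hb e ⟨seqCount a e, by omega⟩).1 (not_le.1 hc)
      have h2 := (h ⟨seqCount a e, by omega⟩).1
      have h3 := (lt_seqCount_iff ha e _).2 (h1.trans_le h2)
      simp at h3
    · by_contra hc
      have hi := seqCount_le a e
      have h1 := (lt_seqCount_iff ha e ⟨seqCount b e + 1, by omega⟩).1 (not_le.1 hc)
      have h2 := (h ⟨seqCount b e, by omega⟩).2
      have h3 := (lt_seqCount_iff hb e _).2 (h1.trans_le h2)
      simp at h3
  · intro h j
    constructor
    · by_contra hc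
      have h1 := (lt_seqCount_iff hb _ j).2 (not_le.1 hc)
      have h2 := (lt_seqCount_iff ha _ j.castSucc).1 (h1.trans_le (h _).1)
      omega
    · by_contra hc
      have h1 := (lt_seqCount_iff ha _ j.succ).2 (not_le.1 hc)
      have h2 := (h (b j)).2
      rw [Fin.val_succ] at h1
      have h3 := (lt_seqCount_iff hb (b j) j).1 (by omega)
      omega

/-- Conservation of particles along a row. -/
theorem colCount_flow {N : ℕ} {top bot : Fin N → Bool} {h : Fin (N + 1) → Bool}
    (hs : ∀ c, SixVertex (h c.succ) (h c.castSucc) (top c) (bot c)) (hl : h (Fin.last N) = true)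
    (e : Fin (N + 1)) : colCount top e = colCount bot e + if h e = true then 0 else 1 := by
  induction e using Fin.reverseInduction with
  | last => simp [hl, colCount_of_le]
  | cast c ih =>
    have h1 := hs c
    rw [Fin.val_succ] at ih
    rw [Fin.val_castSucc, colCount_succ, colCount_succ, ih]
    revert h1
    cases h c.succ <;> cases h c.castSucc <;> cases top c <;> cases bot c <;>
      simp [SixVertex]

/-- The horizontal edges of a row, determined by its vertical edges. -/
def flowEdges {N : ℕ} (top bot : Fin N → Bool) (e : Fin (N + 1)) : Bool :=
  decide (colCount top e = colCount bot e)

theorem sixVertex_flowEdges {N : ℕ} {top bot : Fin N → Bool}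
    (h : ∀ e, colCount bot e ≤ colCount top e ∧ colCount top e ≤ colCount bot e + 1) (c : Fin N) :
    SixVertex (flowEdges top bot c.succ) (flowEdges top bot c.castSucc) (top c) (bot c) := by
  have h1 := h c
  have h2 := h (c + 1)
  rw [colCount_succ, colCount_succ] at h1
  simp only [SixVertex, flowEdges, Fin.val_succ, Fin.val_castSucc, colCount_succ _ c,
    decide_eq_true_eq, decide_eq_false_iff_not]
  clear h
  revert h1
  cases top c <;> cases bot c <;> intro h1 <;>
    simp only [Bool.false_eq_true, Bool.true_eq_false, if_true, if_false] at h1 ⊢ <;>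
    split_ifs <;> omega

theorem exists_strictAnti_marks {N i : ℕ} {u : Fin N → Bool} (h : colCount u 0 = i) :
    ∃ a : Fin i → ℕ, StrictAnti a ∧ (∀ k, 0 < a k) ∧ (∀ k, a k ≤ N) ∧ marks N a = u := by
  have hF : (univ.filter fun c : Fin N => u c = true).card = i := by
    rw [← h, colCount]; simp
  let f := (univ.filter fun c : Fin N => u c = true).orderEmbOfFin hF
  refine ⟨fun k => (f k.rev : ℕ) + 1, ?_, fun k => Nat.succ_pos _, fun k => (f k.rev).isLt, ?_⟩
  · intro j k hjk
    have : f k.rev < f j.rev := f.strictMono (Fin.rev_lt_rev.2 hjk)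
    exact Nat.succ_lt_succ this
  · funext c
    refine Bool.eq_iff_iff.2 ((marks_eq_true_iff _ c).trans ⟨?_, fun hc => ?_⟩)
    · rintro ⟨k, hk⟩
      have h1 : f k.rev = c := Fin.ext (Nat.succ_injective hk)
      have h2 := orderEmbOfFin_mem _ hF k.rev
      change f k.rev ∈ _ at h2
      rw [h1] at h2
      exact (mem_filter.1 h2).2
    · have h1 : c ∈ Set.range f := by
        rw [range_orderEmbOfFin]
        simpa using hc
      obtain ⟨k, hk⟩ := h1
      exact ⟨k.rev, by simp [hk]⟩

end Counting

/-! ### The bijection between ice states and strict patterns. -/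

section Patterns

variable {n : ℕ}

/-- Interleaving squeezes each entry between two entries of the row above, up to the top row. Thus
every entry is an actual column of the grid. -/
theorem StrictGTPattern.row_bounds (T : StrictGTPattern n) {M : ℕ}
    (hpos : ∀ k, 0 < T.top k) (hle : ∀ k, T.top k ≤ M) (i : ℕ) (hi : i ≤ n) (k : Fin i) :
    0 < T.row i hi k ∧ T.row i hi k ≤ M := by
  obtain ⟨d, hd⟩ := Nat.exists_eq_add_of_le hi
  induction d generalizing i with
  | zero =>
    obtain rfl : i = n := by omega
    exact ⟨hpos k, hle k⟩
  | succ d ih =>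
    have h1 := T.interleave i (by omega) k
    have h2 := ih (i + 1) (by omega) k.succ (by omega)
    have h3 := ih (i + 1) (by omega) k.castSucc (by omega)
    exact ⟨h2.1.trans_le h1.2, h1.1.trans h3.2⟩

theorem corresponds_iff {N : ℕ} {A : IceConfig n N} {T : StrictGTPattern n} :
    Corresponds A T ↔ ∀ s : Fin (n + 1), A.up s = marks N (T.row s (Nat.lt_succ_iff.mp s.isLt)) := by
  refine forall_congr' fun s => ⟨fun h => ?_, fun h c => ?_⟩
  · funext c
    exact Bool.eq_iff_iff.2 ((h c).trans (marks_eq_true_iff _ c).symm)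
  · rw [h, marks_eq_true_iff]

variable [NeZero n] {lam : Fin n → ℕ}

theorem mem_iceStates {A : IceConfig n (lam 0)} : A ∈ iceStates lam ↔ A.IsAdmissible lam := by
  simp [iceStates]

theorem IceConfig.IsAdmissible.flow {A : IceConfig n (lam 0)} (hA : A.IsAdmissible lam) (r : Fin n)
    (e : Fin (lam 0 + 1)) : colCount (A.up r.succ) e =
      colCount (A.up r.castSucc) e + if A.right r e = true then 0 else 1 :=
  colCount_flow (fun c => hA.balanced r c) (hA.left_boundary r) e

/-- The right boundary edge points left, so conservation gives each level exactly one more particle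
than the level below. -/
theorem IceConfig.IsAdmissible.colCount_up {A : IceConfig n (lam 0)} (hA : A.IsAdmissible lam)
    (s : Fin (n + 1)) : colCount (A.up s) 0 = s := by
  induction s using Fin.induction with
  | zero => simp [colCount, hA.bottom_boundary]
  | succ r ih =>
    have h := hA.flow r 0
    rw [hA.right_boundary r, Fin.val_zero, ih] at h
    simpa using h

theorem IceConfig.IsAdmissible.up_last {A : IceConfig n (lam 0)} (hA : A.IsAdmissible lam) :
    A.up (Fin.last n) = marks (lam 0) lam := by
  funext c
  exact Bool.eq_iff_iff.2 ((hA.top_boundary c).trans (marks_eq_true_iff lam c).symm)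

theorem le_first (hlam : StrictAnti lam) (k : Fin n) : lam k ≤ lam 0 :=
  hlam.antitone (Fin.zero_le k)

theorem existsUnique_pattern (hlam : StrictAnti lam) (hpos : ∀ i, 0 < lam i)
    {A : IceConfig n (lam 0)} (hA : A.IsAdmissible lam) :
    ∃! T : StrictGTPattern n, T.top = lam ∧ Corresponds A T := by
  have hex : ∀ (i : ℕ) (hi : i ≤ n), ∃ a : Fin i → ℕ, StrictAnti a ∧ (∀ k, 0 < a k) ∧
      (∀ k, a k ≤ lam 0) ∧ marks (lam 0) a = A.up ⟨i, Nat.lt_succ_of_le hi⟩ := fun i hi =>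
    exists_strictAnti_marks (hA.colCount_up ⟨i, Nat.lt_succ_of_le hi⟩)
  choose row hanti hrpos hrle hmarks using hex
  let T : StrictGTPattern n :=
    { row := row
      strict := hanti
      interleave := fun i hi => by
        refine (interleave_iff (hanti (i + 1) hi) (hanti i _)).2 fun e => ?_
        rw [← colCount_marks (hanti (i + 1) hi) (hrpos _ _) (hrle _ _),
          ← colCount_marks (hanti i (Nat.le_of_succ_le hi)) (hrpos _ _) (hrle _ _), hmarks, hmarks]
        -- Conservation applies at places of the grid; beyond the leftmost column both counts
        -- vanish.
        by_cases he : e < lam 0 + 1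
        · have := hA.flow ⟨i, hi⟩ ⟨e, he⟩
          simp only [Fin.succ_mk, Fin.castSucc_mk] at this
          rw [this]
          split_ifs <;> omega
        · rw [colCount_of_le _ (by omega), colCount_of_le _ (by omega)]
          omega }
  have hT : Corresponds A T := corresponds_iff.2 fun s => (hmarks s _).symm
  refine ⟨T, ⟨?_, hT⟩, ?_⟩
  · refine eq_of_marks_eq (N := lam 0) (hanti n le_rfl) hlam (hrpos _ _) (hrle _ _) hpos
      (le_first hlam) ?_
    rw [← hA.up_last]
    exact hmarks n le_rfl
  · rintro T' ⟨htop, hT'⟩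
    ext1
    funext i hi
    have hb := T'.row_bounds (M := lam 0) (fun k => htop ▸ hpos k)
      (fun k => htop ▸ le_first hlam k) i hi
    refine eq_of_marks_eq (N := lam 0) (T'.strict i hi) (hanti i hi) (fun k => (hb k).1)
      (fun k => (hb k).2) (hrpos _ _) (hrle _ _) ?_
    rw [hmarks]
    exact (corresponds_iff.1 hT' ⟨i, Nat.lt_succ_of_le hi⟩).symm

/-- The pattern prescribes the vertical edges. Conservation forces the horizontal ones, and
interleaving makes the forced choice balanced. -/
theorem existsUnique_state (hlam : StrictAnti lam) (hpos : ∀ i, 0 < lam i)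
    {T : StrictGTPattern n} (hT : T.top = lam) :
    ∃! A, A ∈ iceStates lam ∧ Corresponds A T := by
  have hb := T.row_bounds (M := lam 0) (fun k => hT ▸ hpos k) (fun k => hT ▸ le_first hlam k)
  have hcount : ∀ i hi e, colCount (marks (lam 0) (T.row i hi)) e = seqCount (T.row i hi) e :=
    fun i hi => colCount_marks (T.strict i hi) (fun k => (hb i hi k).1) fun k => (hb i hi k).2
  let up : Fin (n + 1) → Fin (lam 0) → Bool :=
    fun s => marks (lam 0) (T.row s (Nat.lt_succ_iff.mp s.isLt))
  let A : IceConfig n (lam 0) := ⟨up, fun r => flowEdges (up r.succ) (up r.castSucc)⟩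
  have hAT : Corresponds A T := corresponds_iff.2 fun s => rfl
  have hA : A.IsAdmissible lam := by
    refine ⟨fun r c => sixVertex_flowEdges (fun e => ?_) c, fun r => ?_, fun r => ?_, fun c => ?_,
      fun c => ?_⟩
    · simp only [up, hcount]
      exact (interleave_iff (T.strict _ _) (T.strict _ _)).1 (T.interleave r r.isLt) e
    · simp [A, flowEdges, colCount_of_le]
    · simp only [A, flowEdges, up, Fin.val_zero, hcount]
      rw [seqCount_zero fun k => (hb _ _ k).1, seqCount_zero fun k => (hb _ _ k).1]
      simp
    · refine Bool.eq_false_iff.2 fun h => ?_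
      obtain ⟨k, -⟩ := (hAT 0 c).1 h
      exact k.elim0
    · refine (hAT (Fin.last n) c).trans ?_
      change (∃ k, T.top k = _) ↔ _
      rw [hT]
  refine ⟨A, ⟨mem_iceStates.2 hA, hAT⟩, ?_⟩
  rintro A' ⟨hA', hA'T⟩
  have hA' := mem_iceStates.1 hA'
  have hup : A'.up = A.up := funext fun s => corresponds_iff.1 hA'T s
  refine IceConfig.ext hup ?_
  funext r e
  have h1 := hA.flow r e
  have h2 := hA'.flow r e
  rw [hup, h1] at h2
  revert h2
  cases A.right r e <;> cases A'.right r e <;> simp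

end Patterns

/-! ## Bra-kets as row weights -/

section BraKets

open Finset

variable {K : Type*} [Field K]

theorem ket_eq_colVec {i N : ℕ} {a : Fin i → ℕ} (ha : StrictAnti a) (hpos : ∀ k, 0 < a k)
    (hle : ∀ k, a k ≤ N) : ket (K := K) a = colVec K (marks N a) := by
  induction i with
  | zero =>
    rw [ket, List.ofFn_zero, List.prod_nil, Module.End.one_apply, vacuum, colVec]
    congr 1
    ext k
    simp [colMaya, Maya.vac, marks]
  | succ i ih =>
    have ha' : StrictAnti fun k : Fin i => a k.succ := fun j k h => ha (Fin.succ_lt_succ_iff.2 h)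
    have ih' := ih ha' (fun k => hpos _) fun k => hle _
    rw [ket] at ih' ⊢
    rw [List.ofFn_succ, List.prod_cons, Module.End.mul_apply, ih', colVec, colVec]
    have hlt : ∀ j ∈ (colMaya (marks N fun k : Fin i => a k.succ)).carrier, j < (a 0 : ℤ) := by
      rintro j (h | ⟨c, hc, rfl⟩)
      · have := hpos 0; omega
      · obtain ⟨k, hk⟩ := (marks_eq_true_iff _ c).1 hc
        have := ha (Fin.succ_pos k)
        omega
    rw [psiStar_single, if_neg fun h => lt_irrefl _ (hlt _ h),
      numRight_eq_zero fun j hj => (hlt j hj).le, pow_zero, mul_one]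
    congr 1
    ext k
    simp only [Maya.add, colMaya, Set.mem_insert_iff, Set.mem_ofPred_eq, marks_eq_true_iff,
      Fin.exists_fin_succ]
    constructor
    · rintro (rfl | h | ⟨c, hc, rfl⟩)
      · have h0 := hpos 0
        have h1 := hle 0
        exact Or.inr ⟨⟨a 0 - 1, by omega⟩, Or.inl (by simp; omega), by simp; omega⟩
      · exact Or.inl h
      · exact Or.inr ⟨c, Or.inr hc, rfl⟩
    · rintro (h | ⟨c, hc | hc, rfl⟩)
      · exact Or.inr (Or.inl h)
      · exact Or.inl (by rw [hc]; push_cast; ring)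
      · exact Or.inr (Or.inr ⟨c, hc, rfl⟩)

theorem bra_eq {i N : ℕ} {a : Fin i → ℕ} (ha : StrictAnti a) (hpos : ∀ k, 0 < a k)
    (hle : ∀ k, a k ≤ N) (v : Fock K) : bra a v = v (colMaya (marks N a)) := by
  rw [bra_eq_pairing, ket_eq_colVec ha hpos hle, colVec, pairing_single, one_mul]

theorem braket_eq {i j N : ℕ} {b : Fin j → ℕ} (hb : StrictAnti b) (hpos : ∀ k, 0 < b k)
    (hle : ∀ k, b k ≤ N) {A : OpSeries K} {B : Module.End K (Fock K)} (h : SumsTo A B)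
    (a : Fin i → ℕ) : braket b A a = B (ket a) (colMaya (marks N b)) := by
  rw [braket, ← Finsupp.applyAddHom_apply, ← h.finsum]
  exact finsum_congr fun d => bra_eq hb hpos hle _

theorem sum_smul_colVec {N : ℕ} (f : (Fin N → Bool) → K) (u : Fin N → Bool) :
    (∑ v, f v • colVec K v) (colMaya u) = f u := by
  classical
  rw [Finsupp.finsetSum_apply, sum_eq_single u]
  · simp [colVec]
  · intro v _ hv
    rw [Finsupp.smul_apply, colVec, Finsupp.single_apply, if_neg, smul_zero]
    exact fun h => hv (colMaya_injective h)
  · simp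

theorem braket_delta [CharZero K] (x t : K) {i j N : ℕ} {a : Fin i → ℕ} {b : Fin j → ℕ}
    (ha : StrictAnti a) (hapos : ∀ k, 0 < a k) (hale : ∀ k, a k ≤ N)
    (hb : StrictAnti b) (hbpos : ∀ k, 0 < b k) (hble : ∀ k, b k ≤ N) :
    braket b (expOp (phiPlus x t) * op (psi K 0)) a = (-1) ^ i * (t + 1) * x *
      rowSum (deltaVertex x t) N (marks N a) (marks N b) true false := by
  obtain ⟨v, hv, h⟩ := halfVertex_psi_colVec x t (marks N a)
  rw [braket_eq hb hbpos hble ((sumsTo_halfVertex x t).mul (sumsTo_op _)),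
    ket_eq_colVec ha hapos hale, Module.End.mul_apply, h, Finsupp.add_apply,
    colMaya_eq_zero_of_psi_eq_zero hv, zero_add, sum_smul_colVec, numOcc_marks ha hapos hale]

theorem isAdjSeries_gamma (x t : K) (k : ℤ) :
    IsAdjSeries (op (psi K k) * expOp (phiMinus x t))
      (expOp (phiPlus x⁻¹ t) * op (psiStar K k)) :=
  (isAdjSeries_op (isAdj_psi_psiStar k)).mul (isAdjSeries_phi x t).expOp

theorem braket_gamma [CharZero K] {x : K} (hx : x ≠ 0) (t : K) {i j N : ℕ} {a : Fin i → ℕ}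
    {b : Fin j → ℕ} (ha : StrictAnti a) (hapos : ∀ k, 0 < a k) (hale : ∀ k, a k ≤ N)
    (hb : StrictAnti b) (hbpos : ∀ k, 0 < b k) (hble : ∀ k, b k ≤ N) :
    braket b (op (psi K ((N : ℤ) + 1)) * expOp (phiMinus x t)) a = (t + 1) * x ^ (-(N : ℤ)) *
      rowSum (gammaVertex x t) N (marks N a) (marks N b) true false := by
  obtain ⟨v, h⟩ := halfVertex_psiStar_colVec hx t (marks N b)
  -- Transposing puts the lower row `b` into the ket, so the row is traversed upside down;
  -- coefficients at configurations with column `N + 1` empty do not see the error term.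
  rw [braket_adjoint _ _ (isAdjSeries_gamma x t _),
    braket_eq ha hapos hale ((sumsTo_halfVertex x⁻¹ t).mul (sumsTo_op _)),
    ket_eq_colVec hb hbpos hble, Module.End.mul_apply, h, Finsupp.add_apply, colMaya_psiStar,
    zero_add, sum_smul_colVec]

theorem marks_elim0 (N : ℕ) : marks N (Fin.elim0 : Fin 0 → ℕ) = fun _ => false := by
  funext c
  simp [marks]

theorem ket_elim0 : ket (Fin.elim0 : Fin 0 → ℕ) = vacuum K := by
  rw [ket, List.ofFn_zero, List.prod_nil, Module.End.one_apply]

end BraKets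

/-! ### Weights of rows and partition functions. -/

section Rows

open Finset

variable {K : Type*} [Field K] {n : ℕ} [NeZero n] {lam : Fin n → ℕ}

theorem wtDeltaRow_eq {A : IceConfig n (lam 0)} (hA : A.IsAdmissible lam)
    {T : StrictGTPattern n} (hAT : Corresponds A T) (x t : Fin n → K) (r : Fin n) :
    wtDeltaRow x t A r = rowSum (deltaVertex (x r) (t r)) (lam 0)
      (marks (lam 0) (T.row (r + 1) r.isLt)) (marks (lam 0) (T.row r r.isLt.le)) true false := by
  have h := prod_eq_rowSum (fun _ _ _ _ => deltaVertex_eq_zero (x r) (t r))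
    (h := A.right r) fun c => hA.balanced r c
  rw [hA.left_boundary, hA.right_boundary] at h
  refine h.trans ?_
  congr 1
  · exact corresponds_iff.1 hAT r.succ
  · exact corresponds_iff.1 hAT r.castSucc

theorem wtGammaRow_eq {A : IceConfig n (lam 0)} (hA : A.IsAdmissible lam)
    {T : StrictGTPattern n} (hAT : Corresponds A T) (x t : Fin n → K) (r : Fin n) :
    wtGammaRow x t A r = rowSum (gammaVertex (x r.rev) (t r.rev)) (lam 0)
      (marks (lam 0) (T.row (r + 1) r.isLt)) (marks (lam 0) (T.row r r.isLt.le)) true false := by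
  have h := prod_eq_rowSum (fun _ _ _ _ => gammaVertex_eq_zero (x r.rev) (t r.rev))
    (h := A.right r) fun c => hA.balanced r c
  rw [hA.left_boundary, hA.right_boundary] at h
  refine h.trans ?_
  congr 1
  · exact corresponds_iff.1 hAT r.succ
  · exact corresponds_iff.1 hAT r.castSucc

theorem ZDelta_eq_braket [CharZero K] (hlam : StrictAnti lam) (hpos : ∀ i, 0 < lam i)
    (x t : Fin n → K) :
    (∏ r : Fin n, (-1) ^ ((r : ℕ) + 1) * (t r + 1) * x r) * ZDelta x t lam =
      braket (Fin.elim0 : Fin 0 → ℕ)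
        (List.ofFn fun r : Fin n => expOp (phiPlus (x r) (t r)) * op (psi K 0)).prod lam := by
  have h := SumsTo.list_prod (List.finRange n) fun r : Fin n =>
    (sumsTo_halfVertex (x r) (t r)).mul (sumsTo_op (psi K 0))
  rw [← List.ofFn_eq_map, ← List.ofFn_eq_map] at h
  rw [braket_eq (N := lam 0) (fun i => i.elim0) (fun i => i.elim0) (fun i => i.elim0) h,
    marks_elim0, colMaya_false, ket_eq_colVec hlam hpos (le_first hlam),
    (list_prod_delta x t).2, ZDelta]
  congr 1
  exact sum_iceStates lam (w := fun r => deltaVertex (x r) (t r))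
    fun r _ _ _ _ => deltaVertex_eq_zero (x r) (t r)

theorem ZGamma_eq_braket [CharZero K] (hlam : StrictAnti lam) (hpos : ∀ i, 0 < lam i)
    {x : Fin n → K} (t : Fin n → K) (hx : ∀ i, x i ≠ 0) :
    (∏ r : Fin n, (t r.rev + 1) * x r.rev ^ (-(lam 0 : ℤ))) * ZGamma x t lam =
      braket (Fin.elim0 : Fin 0 → ℕ)
        (List.ofFn fun r : Fin n =>
          op (psi K ((lam 0 : ℤ) + 1)) * expOp (phiMinus (x r.rev) (t r.rev))).prod lam := by
  -- Transposition reverses the order of the factors.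
  have h := SumsTo.list_prod (List.finRange n).reverse fun r : Fin n =>
    (sumsTo_halfVertex (x r.rev)⁻¹ (t r.rev)).mul (sumsTo_op (psiStar K ((lam 0 : ℤ) + 1)))
  have hadj := IsAdjSeries.list_prod (List.finRange n) fun r : Fin n =>
    isAdjSeries_gamma (x r.rev) (t r.rev) ((lam 0 : ℤ) + 1)
  rw [List.map_reverse, List.map_reverse, ← List.ofFn_eq_map, ← List.ofFn_eq_map] at h
  rw [← List.ofFn_eq_map, ← List.ofFn_eq_map] at hadj
  obtain ⟨v, hv⟩ := list_prod_gamma (N := lam 0) (x := fun r : Fin n => x r.rev)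
    (t := fun r => t r.rev) fun r => hx _
  rw [braket_adjoint _ _ hadj, braket_eq hlam hpos (le_first hlam) h, ket_elim0, hv,
    Finsupp.add_apply, colMaya_psiStar, zero_add, sum_smul_colVec, ZGamma]
  congr 1
  exact sum_iceStates lam (w := fun r => gammaVertex (x r.rev) (t r.rev))
    fun r _ _ _ _ => gammaVertex_eq_zero (x r.rev) (t r.rev)

end Rows

end IceFock

theorem mainTheorem3 {K : Type*} [Field K] [CharZero K] {n : ℕ} [NeZero n]
    (lam : Fin n → ℕ) (hlam : StrictAnti lam) (hpos : ∀ i, 0 < lam i)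
    (x t : Fin n → K) (hx : ∀ i, x i ≠ 0) :
    -- states with top row `lam` are the same as strict patterns with top row `lam`
    (∀ A ∈ iceStates lam, ∃! T : StrictGTPattern n, T.top = lam ∧ Corresponds A T) ∧
    (∀ T : StrictGTPattern n, T.top = lam → ∃! A, A ∈ iceStates lam ∧ Corresponds A T) ∧
    (∀ A ∈ iceStates lam, ∀ T : StrictGTPattern n, T.top = lam → Corresponds A T →
      -- row `i = r + 1`, from `λ^{(i)}` to `λ^{(i-1)}`
      (∀ r : Fin n,
        (-1) ^ ((r : ℕ) + 1) * (t r + 1) * x r * wtDeltaRow x t A r =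
          braket (T.row r r.isLt.le)
            (expOp (phiPlus (x r) (t r)) * op (psi K 0))
            (T.row (r + 1) r.isLt)) ∧
      (∀ r : Fin n,
        (t r.rev + 1) * x r.rev ^ (-(lam 0 : ℤ)) * wtGammaRow x t A r =
          braket (T.row r r.isLt.le)
            (op (psi K ((lam 0 : ℤ) + 1)) * expOp (phiMinus (x r.rev) (t r.rev)))
            (T.row (r + 1) r.isLt)) ∧
      -- the whole state
      (∏ r : Fin n, (-1) ^ ((r : ℕ) + 1) * (t r + 1) * x r) * wtDelta x t A =
        ∏ r : Fin n, braket (T.row r r.isLt.le)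
          (expOp (phiPlus (x r) (t r)) * op (psi K 0))
          (T.row (r + 1) r.isLt) ∧
      (∏ r : Fin n, (t r.rev + 1) * x r.rev ^ (-(lam 0 : ℤ))) * wtGamma x t A =
        ∏ r : Fin n, braket (T.row r r.isLt.le)
          (op (psi K ((lam 0 : ℤ) + 1)) * expOp (phiMinus (x r.rev) (t r.rev)))
          (T.row (r + 1) r.isLt)) ∧
    -- the partition functions
    (∏ r : Fin n, (-1) ^ ((r : ℕ) + 1) * (t r + 1) * x r) * ZDelta x t lam =
      braket (Fin.elim0 : Fin 0 → ℕ)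
        (List.ofFn fun r : Fin n => expOp (phiPlus (x r) (t r)) * op (psi K 0)).prod
        lam ∧
    (∏ r : Fin n, (t r.rev + 1) * x r.rev ^ (-(lam 0 : ℤ))) * ZGamma x t lam =
      braket (Fin.elim0 : Fin 0 → ℕ)
        (List.ofFn fun r : Fin n =>
          op (psi K ((lam 0 : ℤ) + 1)) * expOp (phiMinus (x r.rev) (t r.rev))).prod
        lam := by
  have hrow : ∀ A ∈ iceStates lam, ∀ T : StrictGTPattern n, T.top = lam → Corresponds A T →
      (∀ r : Fin n,
        (-1) ^ ((r : ℕ) + 1) * (t r + 1) * x r * wtDeltaRow x t A r =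
          braket (T.row r r.isLt.le)
            (expOp (phiPlus (x r) (t r)) * op (psi K 0))
            (T.row (r + 1) r.isLt)) ∧
      (∀ r : Fin n,
        (t r.rev + 1) * x r.rev ^ (-(lam 0 : ℤ)) * wtGammaRow x t A r =
          braket (T.row r r.isLt.le)
            (op (psi K ((lam 0 : ℤ) + 1)) * expOp (phiMinus (x r.rev) (t r.rev)))
            (T.row (r + 1) r.isLt)) := by
    intro A hA T hT hAT
    have hA := mem_iceStates.1 hA
    have hb := T.row_bounds (M := lam 0) (fun k => hT ▸ hpos k) fun k => hT ▸ le_first hlam k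
    refine ⟨fun r => ?_, fun r => ?_⟩
    · rw [wtDeltaRow_eq hA hAT]
      exact (braket_delta _ _ (T.strict _ _) (fun k => (hb _ _ k).1) (fun k => (hb _ _ k).2)
        (T.strict _ _) (fun k => (hb _ _ k).1) fun k => (hb _ _ k).2).symm
    · rw [wtGammaRow_eq hA hAT]
      exact (braket_gamma (hx _) _ (T.strict _ _) (fun k => (hb _ _ k).1)
        (fun k => (hb _ _ k).2) (T.strict _ _) (fun k => (hb _ _ k).1) fun k => (hb _ _ k).2).symm
  refine ⟨fun A hA => existsUnique_pattern hlam hpos (mem_iceStates.1 hA),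
    fun T hT => existsUnique_state hlam hpos hT, fun A hA T hT hAT => ?_,
    ZDelta_eq_braket hlam hpos x t, ZGamma_eq_braket hlam hpos t hx⟩
  obtain ⟨h1, h2⟩ := hrow A hA T hT hAT
  refine ⟨h1, h2, ?_, ?_⟩
  · rw [wtDelta, ← Finset.prod_mul_distrib]
    exact Finset.prod_congr rfl fun r _ => h1 r
  · rw [wtGamma, ← Finset.prod_mul_distrib]
    exact Finset.prod_congr rfl fun r _ => h2 r
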